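/- Let $R\subseteq B(\mathcal H)$ be the hyperfinite ${\rm II}_1$ factor, with faithful normal tracial state $\tau$, acting on a complex Hilbert space $\mathcal H$. Let $\theta\in(0,1)$ be irrational and let $u,v\in R$ be unitary operators such that $R=\{u,v\}''$ and $vu=e^{2\pi i\theta}uv$. Let $m$ be normalized Lebesgue measure on the unit circle $S^1$ and let $f\in L^\infty(S^1,m)$. Let $f(v)$ and $|f|(v)$ be the operators obtained from $f$ and $|f|$ by the functional calculus of $v$, that is, $\langle \xi,f(v)\xi\rangle=\int_{S^1} f\,d\mu_\xi$ for every $\xi\in\mathcal H$, where $\mu_\xi$ is the finite Borel measure on $S^1$ with $\int_{S^1} z^n\,d\mu_\xi(z)=\langle \xi,v^n\xi\rangle$ for all $n\in\mathbb Z$, and likewise for $|f|$. Suppose that $m(\{z\in S^1: f(z)=0\})=0$ and that $|f|(v)$ is not a scalar multiple of the identity. Then the von Neumann algebra $N=W^*(uf(v))=\{uf(v),(uf(v))^*\}''$ is an irreducible subfactor of $R$, that is, $N\subseteq R$, $N$ is a ${\rm II}_1$ factor and $N'\cap R=\mathbb C1$, and its Jones index $[R:N]=\dim_N L^2(R,\tau)$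 equals $n$ for some positive integer $n$. -/

import Mathlib

open scoped ENNReal InnerProductSpace ComplexOrder

universe w

/-! ### Lebesgue measure on the unit circle -/

/-- The Borel `σ`-algebra of the unit circle. -/
noncomputable instance Circle.instBorelMeasurableSpace : MeasurableSpace Circle := borel Circle

instance Circle.instBorelSpace : BorelSpace Circle := ⟨rfl⟩

/-- Normalized Lebesgue (= Haar) measure on the unit circle `S¹ ⊆ ℂ`: the image of Haar measure
on `ℝ / ℤ` under `t ↦ exp (2 π i t)`. -/
noncomputable def circleMeasure : MeasureTheory.Measure Circle :=
  MeasureTheory.Measure.map (AddCircle.toCircle (T := (1 : ℝ))) AddCircle.haarAddCircle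

namespace VonNeumannAlgebra

variable {H : Type w} [NormedAddCommGroup H] [InnerProductSpace ℂ H] [CompleteSpace H]

/-! ### A von Neumann algebra as an ordered C⋆-algebra -/

instance instSMulMemClass : SMulMemClass (VonNeumannAlgebra H) ℂ (H →L[ℂ] H) where
  smul_mem {s} c _ hx := s.toStarSubalgebra.smul_mem hx c

instance isClosed_coe (M : VonNeumannAlgebra H) : IsClosed (M : Set (H →L[ℂ] H)) := by
  rw [← M.centralizer_centralizer]
  exact Set.isClosed_centralizer _

/-- `M` carries the usual order of operators; its positive elements are the `s* s` with `s` in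
`M`. -/
instance instStarOrderedRing (M : VonNeumannAlgebra H) : StarOrderedRing M := by
  refine StarOrderedRing.of_nonneg_iff' (fun {x y} h z => ?_) (fun x => ⟨fun hx => ?_, ?_⟩)
  · exact add_le_add_right (α := H →L[ℂ] H) h (z : H →L[ℂ] H)
  · have hx' : (0 : H →L[ℂ] H) ≤ (x : H →L[ℂ] H) := hx
    have hmem : cfc (fun t : ℝ => Real.sqrt t) (x : H →L[ℂ] H) ∈ M :=
      haveI := isClosed_coe M
      cfc_mem _ x.2
    have hsa : IsSelfAdjoint (cfc (fun t : ℝ => Real.sqrt t) (x : H →L[ℂ] H)) :=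
      cfc_predicate _ _
    refine ⟨⟨_, hmem⟩, Subtype.ext ?_⟩
    change (x : H →L[ℂ] H) = star (cfc (fun t : ℝ => Real.sqrt t) (x : H →L[ℂ] H)) *
      cfc (fun t : ℝ => Real.sqrt t) (x : H →L[ℂ] H)
    rw [hsa.star_eq, ← cfc_mul _ _ _]
    conv_lhs => rw [← cfc_id ℝ (x : H →L[ℂ] H) (IsSelfAdjoint.of_nonneg hx')]
    refine cfc_congr fun t ht => ?_
    exact (Real.mul_self_sqrt (spectrum_nonneg_of_nonneg hx' ht)).symm
  · rintro ⟨s, rfl⟩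
    exact star_mul_self_nonneg (s : H →L[ℂ] H)

/-! ### Generation, factors, hyperfiniteness -/

/-- The von Neumann algebra `(S ∪ S*)''` generated by a set `S` of bounded operators; in particular
`generatedBy {T} = W*(T) = {T, T*}''`. -/
noncomputable def generatedBy (S : Set (H →L[ℂ] H)) : VonNeumannAlgebra H where
  toStarSubalgebra :=
    StarSubalgebra.centralizer ℂ (StarSubalgebra.centralizer ℂ S : Set (H →L[ℂ] H))
  centralizer_centralizer' := by
    change Set.centralizer (Set.centralizer
      ((StarSubalgebra.centralizer ℂ (StarSubalgebra.centralizer ℂ S : Set (H →L[ℂ] H)) :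
        Set (H →L[ℂ] H)))) =
      ((StarSubalgebra.centralizer ℂ (StarSubalgebra.centralizer ℂ S : Set (H →L[ℂ] H)) :
        Set (H →L[ℂ] H)))
    rw [StarSubalgebra.coe_centralizer]
    exact Set.centralizer_centralizer_centralizer _

theorem coe_generatedBy (S : Set (H →L[ℂ] H)) :
    (generatedBy S : Set (H →L[ℂ] H)) = Set.centralizer (Set.centralizer (S ∪ star S)) :=
  StarSubalgebra.coe_centralizer_centralizer ℂ S

/-- `M` is a factor: its centre `M ∩ M'` consists of the scalar operators. -/
def IsFactor (M : VonNeumannAlgebra H) : Prop :=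
  ∀ x ∈ M, x ∈ M.commutant → ∃ c : ℂ, x = c • (1 : H →L[ℂ] H)

/-- `N` is irreducible in `M`: the relative commutant `N' ∩ M` consists of the scalar operators. -/
def IsIrreducibleIn (N M : VonNeumannAlgebra H) : Prop :=
  ∀ x ∈ M, x ∈ N.commutant → ∃ c : ℂ, x = c • (1 : H →L[ℂ] H)

/-- `τ` is a faithful normal tracial state on `M`. Normality means that `τ` is ultraweakly
continuous, i.e. of the form `x ↦ ∑ ⟨ξₙ, x ηₙ⟩` with `∑ ‖ξₙ‖² < ∞` and `∑ ‖ηₙ‖² < ∞`. -/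
structure IsTrace {M : VonNeumannAlgebra H} (τ : M →ₚ[ℂ] ℂ) : Prop where
  map_one : τ 1 = 1
  tracial : ∀ x y : M, τ (x * y) = τ (y * x)
  faithful : ∀ x : M, τ (star x * x) = 0 → x = 0
  normal : ∃ ξ η : ℕ → H, Summable (fun n => ‖ξ n‖ ^ 2) ∧ Summable (fun n => ‖η n‖ ^ 2) ∧
    ∀ x : M, HasSum (fun n => ⟪ξ n, (x : H →L[ℂ] H) (η n)⟫_ℂ) (τ x)

/-- `M` is a `II₁` factor: an infinite-dimensional factor with a faithful normal tracial state. -/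
def IsII1Factor (M : VonNeumannAlgebra H) : Prop :=
  M.IsFactor ∧ ¬ FiniteDimensional ℂ M ∧ ∃ τ : M →ₚ[ℂ] ℂ, IsTrace τ

/-- `M` is hyperfinite: it is generated by an increasing sequence of finite-dimensional unital
⋆-subalgebras. -/
def IsHyperfinite (M : VonNeumannAlgebra H) : Prop :=
  ∃ A : ℕ → StarSubalgebra ℂ (H →L[ℂ] H), Monotone A ∧ (∀ n, FiniteDimensional ℂ (A n)) ∧
    Set.centralizer (Set.centralizer (⋃ n, (A n : Set (H →L[ℂ] H)))) = M

/-! ### The Jones index -/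

/-- The inclusion of a von Neumann subalgebra. -/
def incl {N M : VonNeumannAlgebra H} (h : N ≤ M) : N →⋆ₐ[ℂ] M where
  toFun x := ⟨x, h x.2⟩
  map_one' := rfl
  map_mul' _ _ := rfl
  map_zero' := rfl
  map_add' _ _ := rfl
  commutes' _ := rfl
  map_star' _ := rfl

/-- The restriction of a positive functional to a von Neumann subalgebra. -/
noncomputable def restrict {N M : VonNeumannAlgebra H} (h : N ≤ M) (τ : M →ₚ[ℂ] ℂ) :
    N →ₚ[ℂ] ℂ where
  toFun x := τ (incl h x)
  map_add' x y := by simp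
  map_smul' c x := by simp
  monotone' x y hxy := OrderHomClass.mono τ (show incl h x ≤ incl h y from hxy)

/-- The canonical cyclic vector `1̂` of `L²(M, τ)`, the GNS space of `τ`. -/
noncomputable def gnsVector {M : VonNeumannAlgebra H} (τ : M →ₚ[ℂ] ℂ) : τ.GNS :=
  ((τ.toPreGNS 1 : τ.PreGNS) : τ.GNS)

/-- The Murray–von Neumann dimension `dim_N K` of a representation `π` of `N` on `K`, where `N` has
trace `τ` and `L²(N, τ)` is its GNS space, with canonical vector `1̂`. If `V : K → ℓ²(ℕ) ⊗ L²(N, τ)`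
is an `N`-linear isometry, then `V V*` is a projection in the commutant of `N` and `dim_N K` is its
trace `∑ᵢ ⟨V V* (δᵢ ⊗ 1̂), δᵢ ⊗ 1̂⟩ = ∑ᵢ ‖V* (δᵢ ⊗ 1̂)‖²`, which does not depend on `V`; if there is
no such `V`, then `dim_N K = ∞`. -/
noncomputable def moduleDim {N : VonNeumannAlgebra H} (τ : N →ₚ[ℂ] ℂ)
    {K : Type w} [NormedAddCommGroup K] [InnerProductSpace ℂ K] [CompleteSpace K]
    (π : N →⋆ₐ[ℂ] (K →L[ℂ] K)) : ℝ≥0∞ :=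
  ⨅ (V : K →ₗᵢ[ℂ] lp (fun _ : ℕ => τ.GNS) 2)
    (_ : ∀ (y : N) (ξ : K) (i : ℕ), V (π y ξ) i = τ.gnsStarAlgHom y (V ξ i)),
    ∑' i : ℕ, ENNReal.ofReal
      (‖V.toContinuousLinearMap.adjoint (lp.single 2 i (gnsVector τ))‖ ^ 2)

/-- The Jones index `[M : N] = dim_N L²(M, τ)` of a subfactor `N` of the `II₁` factor `M` with
trace `τ`, where `N` acts on `L²(M, τ)` by left multiplication. -/
noncomputable def jonesIndex {M : VonNeumannAlgebra H} (τ : M →ₚ[ℂ] ℂ) (N : VonNeumannAlgebra H)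
    (h : N ≤ M) : ℝ≥0∞ :=
  moduleDim (restrict h τ) (τ.gnsStarAlgHom.comp (incl h))

end VonNeumannAlgebra

/-! ### Functional calculus of a unitary operator -/

section FunctionalCalculus

variable {H : Type w} [NormedAddCommGroup H] [InnerProductSpace ℂ H] [CompleteSpace H]

/-- `μ` is the spectral measure of the unitary `v` at the vector `ξ`: the (unique) finite Borel
measure on the circle with `∫ zⁿ dμ = ⟨ξ, vⁿ ξ⟩` for all integers `n`. -/
def IsSpectralMeasure (v : unitary (H →L[ℂ] H)) (ξ : H) (μ : MeasureTheory.Measure Circle) : Prop :=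
  MeasureTheory.IsFiniteMeasure μ ∧
    ∀ n : ℤ, ∫ z : Circle, ((z ^ n : Circle) : ℂ) ∂μ = ⟪ξ, ((v ^ n : unitary _) : H →L[ℂ] H) ξ⟫_ℂ

/-- `T = f(v) = ∫ f dE`, where `E` is the spectral measure of `v`: this means that
`⟨ξ, T ξ⟩ = ∫ f dμ_ξ` for all vectors `ξ`, where `μ_ξ = ⟨ξ, E(·) ξ⟩` is the spectral measure of `v`
at `ξ`. It determines `T` by polarization. -/
def IsFunctionOf (v : unitary (H →L[ℂ] H)) (f : Circle → ℂ) (T : H →L[ℂ] H) : Prop :=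
  ∀ ξ : H, ∃ μ : MeasureTheory.Measure Circle, IsSpectralMeasure v ξ μ ∧
    MeasureTheory.Integrable f μ ∧ ⟪ξ, T ξ⟫_ℂ = ∫ z, f z ∂μ

open Classical in
/-- The operator `f(v)` given by the functional calculus of the unitary `v`. -/
noncomputable def functionalCalculus (v : unitary (H →L[ℂ] H)) (f : Circle → ℂ) : H →L[ℂ] H :=
  if h : ∃ T, IsFunctionOf v f T then h.choose else 0

end FunctionalCalculus

/-!
Write `f = w |f|` with `|w| = 1`, and put `U = u w(v)` and `P = |f|(v)`, so that `u f(v) = U P`.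
Since `w(v)` commutes with `v`, the unitaries `U, v` satisfy the same commutation relation as `u, v`
and generate `R`. The operator `P` is positive and, as `f ≠ 0` almost everywhere, injective; hence
`N = W*(U P)` contains `P` and `U`, and `N = {U, P}''` (`unitary_mem_of_mul_mem`).

The set of `j` with `vʲ ∈ N` is a subgroup `nℤ` of `ℤ`. Conjugation by `U` rotates the circle
by the irrational angle `θ`, so the averages of `e^{-2πijkθ} U⁻ᵏ P Uᵏ` over `k`, which lie in `N`,
converge to the multiple of `vʲ` by the `j`-th Fourier coefficient of `|f|`, by the mean ergodic
theorem and dominated convergence (`IsLinftyCalc.zpow_mem_of_circleCoeff_ne_zero`). Thus all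
frequencies of `|f|` lie in `nℤ`. This gives `n ≠ 0`, because `|f|` is not constant, and shows that
`|f|` is invariant under rotation by `n`-th roots of unity, whence `P ∈ {vⁿ}''`
(`IsLinftyCalc.mem_of_circleCoeff_eq_zero`). Therefore `N = {U, vⁿ}''`
(`IsLinftyCalc.exists_generatedBy_eq`).

The trace vanishes on the monomials `Uᵃ vᵇ` with `(a, b) ≠ 0`, since each of them commutes with `U`
or with `v` up to a scalar different from `1`. So these monomials form an orthonormal basis of
`L²(R, τ)`, and those with `n ∣ b` one of `L²(N, τ)`; an element of `R` commuting with `U` and `vⁿ`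
has only one nonzero coefficient and is a scalar. The right multiplications by `vʲ`, `0 ≤ j < n`,
identify `L²(R, τ)` with the sum of `n` copies of `L²(N, τ)`, and the index is `n`
(`jonesIndex_eq`).

The functional calculus is handled by approximation. The trace being zero on the nonzero powers of
`v`, the spectral measures of `v` are absolutely continuous with respect to Lebesgue measure
(`spectralMeasure_absolutelyContinuous`), so `f(v)` is the strong limit of `gₖ(v)` for every
uniformly bounded sequence of continuous functions `gₖ` that converges to `f` almost everywhere
(`IsLinftyCalc`).
-/

open MeasureTheory Filter Topology

/-! ### Trigonometric polynomials on the circle -/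

/-- The continuous function `z ↦ zⁿ` on the unit circle. -/
noncomputable def circleMonomial (n : ℤ) : C(Circle, ℂ) :=
  ⟨fun z => ((z ^ n : Circle) : ℂ), continuous_subtype_val.comp (continuous_zpow n)⟩

@[simp]
theorem circleMonomial_apply (n : ℤ) (z : Circle) : circleMonomial n z = ((z ^ n : Circle) : ℂ) :=
  rfl

/-- Trigonometric polynomials are uniformly dense in the continuous functions. -/
theorem mem_of_isClosed_of_circleMonomial_mem {S : Submodule ℂ C(Circle, ℂ)}
    (hS : IsClosed (S : Set C(Circle, ℂ))) (h : ∀ n, circleMonomial n ∈ S) (g : C(Circle, ℂ)) :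
    g ∈ S := by
  have : Fact ((0 : ℝ) < 1) := ⟨one_pos⟩
  let e : AddCircle (1 : ℝ) ≃ₜ Circle := AddCircle.homeomorphCircle one_ne_zero
  let F : C(AddCircle (1 : ℝ), ℂ) →L[ℂ] C(Circle, ℂ) :=
    { toFun := fun k => k.comp (e.symm : C(Circle, AddCircle (1 : ℝ)))
      map_add' := fun _ _ => rfl
      map_smul' := fun _ _ => rfl
      cont := ContinuousMap.continuous_precomp _ }
  have hF : ∀ k, F k ∈ S := by
    intro k
    have hk : k ∈ (Submodule.span ℂ (Set.range (fourier (T := (1 : ℝ))))).topologicalClosure := by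
      rw [span_fourier_closure_eq_top]; trivial
    refine (closure_minimal (t := F ⁻¹' S) ?_ (hS.preimage F.continuous)) hk
    change (Submodule.span ℂ _) ≤ S.comap F.toLinearMap
    rw [Submodule.span_le]
    rintro _ ⟨n, rfl⟩
    have hn : F (fourier n) = circleMonomial n := ?_
    · change F (fourier n) ∈ S
      exact hn ▸ h n
    ext z
    obtain ⟨x, rfl⟩ := e.surjective z
    change fourier n (e.symm (e x)) = _
    rw [e.symm_apply_apply, fourier_apply, circleMonomial_apply, AddCircle.toCircle_zsmul]
    simp [e, AddCircle.homeomorphCircle_apply]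
  have : F (g.comp (e : C(AddCircle (1 : ℝ), Circle))) = g := by
    ext z
    change g (e (e.symm z)) = g z
    rw [e.apply_symm_apply]
  exact this ▸ hF _

/-- Two continuous linear maps on `C(S¹)` that agree on the monomials are equal. -/
theorem eq_of_forall_circleMonomial {E : Type*} [NormedAddCommGroup E] [NormedSpace ℂ E]
    {F G : C(Circle, ℂ) →L[ℂ] E} (h : ∀ n, F (circleMonomial n) = G (circleMonomial n)) :
    F = G := by
  ext g
  exact mem_of_isClosed_of_circleMonomial_mem (S := LinearMap.eqLocus F.toLinearMap G.toLinearMap)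
    (isClosed_eq F.continuous G.continuous) h g

/-- Integration of continuous functions against a finite measure. -/
noncomputable def circleIntegralCLM (μ : Measure Circle) [IsFiniteMeasure μ] :
    C(Circle, ℂ) →L[ℂ] ℂ :=
  LinearMap.mkContinuous
    { toFun := fun g => ∫ z, g z ∂μ
      map_add' := fun g h => integral_add
        (g.continuous.integrable_of_hasCompactSupport (HasCompactSupport.of_compactSpace _))
        (h.continuous.integrable_of_hasCompactSupport (HasCompactSupport.of_compactSpace _))
      map_smul' := fun c g => integral_const_mul c _ } (μ.real Set.univ) (fun g => by
      have := norm_integral_le_of_norm_le_const (μ := μ) (f := g) (C := ‖g‖)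
        (Eventually.of_forall fun z => g.norm_coe_le_norm z)
      rw [mul_comm]; exact this)

@[simp]
theorem circleIntegralCLM_apply (μ : Measure Circle) [IsFiniteMeasure μ] (g : C(Circle, ℂ)) :
    circleIntegralCLM μ g = ∫ z, g z ∂μ := rfl

/-- A finite Borel measure on the circle is determined by its moments. -/
theorem circle_measure_ext {μ ν : Measure Circle} [IsFiniteMeasure μ] [IsFiniteMeasure ν]
    (h : ∀ n : ℤ, ∫ z : Circle, ((z ^ n : Circle) : ℂ) ∂μ =
      ∫ z : Circle, ((z ^ n : Circle) : ℂ) ∂ν) :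
    μ = ν := by
  have key : circleIntegralCLM μ = circleIntegralCLM ν := eq_of_forall_circleMonomial h
  refine ext_of_forall_integral_eq_of_IsFiniteMeasure fun g => ?_
  let g' : C(Circle, ℂ) := ⟨fun z => (g z : ℂ), by fun_prop⟩
  have := DFunLike.congr_fun key g'
  simp only [circleIntegralCLM_apply, g', ContinuousMap.coe_mk, integral_complex_ofReal] at this
  exact_mod_cast this

/-! ### Continuous functional calculus and spectral measures of a unitary -/

section Unitary

variable {H : Type w} [NormedAddCommGroup H] [InnerProductSpace ℂ H] [CompleteSpace H]

/-- The continuous functional calculus of a unitary, on functions defined on the circle. -/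
noncomputable def circleCalc (v : unitary (H →L[ℂ] H)) : C(Circle, ℂ) →⋆ₐ[ℂ] (H →L[ℂ] H) :=
  (cfcHom (p := IsStarNormal) (a := (v : H →L[ℂ] H)) inferInstance).comp
    (ContinuousMap.compStarAlgHom' ℂ ℂ
      ⟨fun z : spectrum ℂ (v : H →L[ℂ] H) =>
        (⟨z.1, Unitary.spectrum_subset_circle (𝕜 := ℂ) v z.2⟩ : Circle), by fun_prop⟩)

theorem circleCalc_continuous (v : unitary (H →L[ℂ] H)) : Continuous (circleCalc v) :=
  (cfcHom_continuous _).comp (ContinuousMap.continuous_precomp _)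

theorem circleCalc_one_monomial (v : unitary (H →L[ℂ] H)) :
    circleCalc v (circleMonomial 1) = v := by
  have h := cfcHom_id (R := ℂ) (p := IsStarNormal) (a := (v : H →L[ℂ] H)) inferInstance
  refine Eq.trans ?_ h
  change cfcHom _ _ = _
  congr 1
  ext z
  let c : Circle := ⟨z.1, Unitary.spectrum_subset_circle (𝕜 := ℂ) v z.2⟩
  change ((c ^ (1 : ℤ) : Circle) : ℂ) = (c : ℂ)
  rw [zpow_one]

theorem circleMonomial_add (m n : ℤ) :
    circleMonomial (m + n) = circleMonomial m * circleMonomial n := by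
  ext z; simp [zpow_add]

theorem circleMonomial_neg (n : ℤ) : circleMonomial (-n) = star (circleMonomial n) := by
  ext z; simp [zpow_neg, ← Circle.coe_inv_eq_conj]

theorem circleMonomial_zero : circleMonomial 0 = 1 := by
  ext z; simp

theorem circleCalc_monomial (v : unitary (H →L[ℂ] H)) (n : ℤ) :
    circleCalc v (circleMonomial n) = ((v ^ n : unitary (H →L[ℂ] H)) : H →L[ℂ] H) := by
  have hnat : ∀ k : ℕ, circleCalc v (circleMonomial k) = (v : H →L[ℂ] H) ^ k := by
    intro k
    induction k with
    | zero => simp [circleMonomial_zero]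
    | succ k ih =>
      push_cast
      rw [circleMonomial_add, map_mul, ih, circleCalc_one_monomial, pow_succ]
  obtain ⟨k, rfl | rfl⟩ := n.eq_nat_or_neg
  · simp [hnat]
  · rw [circleMonomial_neg, map_star, hnat, zpow_neg, zpow_natCast]
    simp [← Unitary.star_eq_inv]

/-- `circleCalc` as a continuous linear map. -/
noncomputable def circleCalcCLM (v : unitary (H →L[ℂ] H)) : C(Circle, ℂ) →L[ℂ] (H →L[ℂ] H) :=
  { (circleCalc v : C(Circle, ℂ) →ₗ[ℂ] (H →L[ℂ] H)) with
    cont := circleCalc_continuous v }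

/-- The functional `g ↦ ⟨ξ, g(v) η⟩` on `C(S¹)`. -/
noncomputable def circleMatrixCoeff (v : unitary (H →L[ℂ] H)) (ξ η : H) : C(Circle, ℂ) →L[ℂ] ℂ :=
  (innerSL ℂ ξ).comp ((ContinuousLinearMap.apply ℂ H η).comp (circleCalcCLM v))

@[simp]
theorem circleMatrixCoeff_apply (v : unitary (H →L[ℂ] H)) (ξ η : H) (g : C(Circle, ℂ)) :
    circleMatrixCoeff v ξ η g = ⟪ξ, circleCalc v g η⟫_ℂ := rfl

theorem IsSpectralMeasure.integral_eq {v : unitary (H →L[ℂ] H)} {ξ : H} {μ : Measure Circle}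
    (hμ : IsSpectralMeasure v ξ μ) (g : C(Circle, ℂ)) :
    ∫ z, g z ∂μ = ⟪ξ, circleCalc v g ξ⟫_ℂ := by
  have := hμ.1
  have : circleIntegralCLM μ = circleMatrixCoeff v ξ ξ :=
    eq_of_forall_circleMonomial fun n => by
      simpa [circleCalc_monomial] using hμ.2 n
  exact DFunLike.congr_fun this g

theorem IsSpectralMeasure.unique {v : unitary (H →L[ℂ] H)} {ξ : H} {μ ν : Measure Circle}
    (hμ : IsSpectralMeasure v ξ μ) (hν : IsSpectralMeasure v ξ ν) : μ = ν := by
  have := hμ.1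
  have := hν.1
  exact circle_measure_ext fun n => (hμ.2 n).trans (hν.2 n).symm

/-- A real function applied to `v` is a square of a self-adjoint operator when the function is
nonnegative, so its matrix coefficients are nonnegative. -/
theorem re_inner_circleCalc_nonneg (v : unitary (H →L[ℂ] H)) (ξ : H) (g : C(Circle, ℝ))
    (hg : 0 ≤ g) :
    0 ≤ (⟪ξ, circleCalc v ⟨fun z => (g z : ℂ), by fun_prop⟩ ξ⟫_ℂ).re := by
  let r : C(Circle, ℂ) := ⟨fun z => (Real.sqrt (g z) : ℂ), by fun_prop⟩
  have h : (⟨fun z => (g z : ℂ), by fun_prop⟩ : C(Circle, ℂ)) = star r * r := by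
    ext z
    have hz : 0 ≤ g z := hg z
    simp only [ContinuousMap.coe_mk, ContinuousMap.mul_apply, ContinuousMap.star_apply, r,
      Complex.star_def, Complex.conj_ofReal]
    rw [← Complex.ofReal_mul, Real.mul_self_sqrt hz]
  rw [h, map_mul, map_star, ContinuousLinearMap.star_eq_adjoint, mul_apply_eq_comp,
    ContinuousLinearMap.adjoint_inner_right]
  exact inner_self_nonneg (𝕜 := ℂ)

theorem exists_isSpectralMeasure (v : unitary (H →L[ℂ] H)) (ξ : H) :
    ∃ μ, IsSpectralMeasure v ξ μ := by
  let toC : CompactlySupportedContinuousMap Circle ℝ → C(Circle, ℂ) :=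
    fun g => ⟨fun z => (g z : ℂ), by fun_prop⟩
  let L : CompactlySupportedContinuousMap Circle ℝ →ₗ[ℝ] ℝ :=
    { toFun := fun g => (circleMatrixCoeff v ξ ξ (toC g)).re
      map_add' := fun g h => by
        have : toC (g + h) = toC g + toC h := by ext z; simp [toC]
        rw [this, map_add, Complex.add_re]
      map_smul' := fun c g => by
        have : toC (c • g) = (c : ℂ) • toC g := by ext z; simp [toC]
        rw [this, map_smul]; simp }
  let Λ : CompactlySupportedContinuousMap Circle ℝ →ₚ[ℝ] ℝ :=
    PositiveLinearMap.mk₀ L fun g hg =>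
      re_inner_circleCalc_nonneg v ξ g.toContinuousMap hg
  let μ := RealRMK.rieszMeasure Λ
  have : IsFiniteMeasure μ := inferInstance
  have hreal : ∀ g : C(Circle, ℝ), ∫ z, (g z : ℂ) ∂μ =
      ⟪ξ, circleCalc v ⟨fun z => (g z : ℂ), by fun_prop⟩ ξ⟫_ℂ := by
    intro g
    have h1 := RealRMK.integral_rieszMeasure Λ ⟨g, HasCompactSupport.of_compactSpace _⟩
    rw [integral_complex_ofReal]
    refine Eq.trans (congrArg Complex.ofReal h1) ?_
    change (((⟪ξ, circleCalc v ⟨fun z => (g z : ℂ), by fun_prop⟩ ξ⟫_ℂ).re : ℝ) : ℂ) = _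
    have hsa : IsSelfAdjoint (circleCalc v ⟨fun z => (g z : ℂ), by fun_prop⟩) := by
      refine IsSelfAdjoint.map ?_ (circleCalc v)
      ext z; simp
    rw [← Complex.conj_eq_iff_re]
    rw [inner_conj_symm, ← ContinuousLinearMap.adjoint_inner_right,
      ← ContinuousLinearMap.star_eq_adjoint, hsa.star_eq]
  refine ⟨μ, inferInstance, fun n => ?_⟩
  rw [← circleCalc_monomial]
  let a : C(Circle, ℝ) := ⟨fun z => (circleMonomial n z).re, by fun_prop⟩
  let b : C(Circle, ℝ) := ⟨fun z => (circleMonomial n z).im, by fun_prop⟩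
  have hab : circleMonomial n = ⟨fun z => (a z : ℂ), by fun_prop⟩ +
      Complex.I • (⟨fun z => (b z : ℂ), by fun_prop⟩ : C(Circle, ℂ)) := by
    ext z; simp [a, b, mul_comm Complex.I, Complex.re_add_im]
  have h : circleIntegralCLM μ (circleMonomial n) = circleMatrixCoeff v ξ ξ (circleMonomial n) := by
    rw [hab, map_add, map_add, map_smul, map_smul]
    exact congrArg₂ (· + ·) (hreal a) (congrArg _ (hreal b))
  exact h

/-- The spectral measure of the unitary `v` at the vector `ξ`. -/
noncomputable def spectralMeasure (v : unitary (H →L[ℂ] H)) (ξ : H) : Measure Circle :=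
  (exists_isSpectralMeasure v ξ).choose

theorem isSpectralMeasure_spectralMeasure (v : unitary (H →L[ℂ] H)) (ξ : H) :
    IsSpectralMeasure v ξ (spectralMeasure v ξ) :=
  (exists_isSpectralMeasure v ξ).choose_spec

instance (v : unitary (H →L[ℂ] H)) (ξ : H) : IsFiniteMeasure (spectralMeasure v ξ) :=
  (isSpectralMeasure_spectralMeasure v ξ).1

theorem integral_spectralMeasure (v : unitary (H →L[ℂ] H)) (ξ : H) (g : C(Circle, ℂ)) :
    ∫ z, g z ∂(spectralMeasure v ξ) = ⟪ξ, circleCalc v g ξ⟫_ℂ :=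
  (isSpectralMeasure_spectralMeasure v ξ).integral_eq g

theorem norm_circleCalc_apply_sq (v : unitary (H →L[ℂ] H)) (ξ : H) (g : C(Circle, ℂ)) :
    ‖circleCalc v g ξ‖ ^ 2 = ∫ z, ‖g z‖ ^ 2 ∂(spectralMeasure v ξ) := by
  have h := integral_spectralMeasure v ξ (star g * g)
  rw [map_mul, map_star, ContinuousLinearMap.star_eq_adjoint, mul_apply_eq_comp,
    ContinuousLinearMap.adjoint_inner_right, inner_self_eq_norm_sq_to_K] at h
  have h2 : ∀ z, (star g * g) z = ((‖g z‖ ^ 2 : ℝ) : ℂ) := fun z => by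
    simp [← Complex.normSq_eq_conj_mul_self, Complex.normSq_eq_norm_sq]
  simp only [h2, integral_complex_ofReal] at h
  exact Complex.ofReal_injective (by rw [h]; push_cast; rfl)

theorem circleCalc_mem {v : unitary (H →L[ℂ] H)} (M : VonNeumannAlgebra H)
    (hv : (v : H →L[ℂ] H) ∈ M) (g : C(Circle, ℂ)) : circleCalc v g ∈ M := by
  have hvs : star (v : H →L[ℂ] H) ∈ M := star_mem hv
  refine mem_of_isClosed_of_circleMonomial_mem
    (S := Submodule.comap (circleCalcCLM v).toLinearMap M.toStarSubalgebra.toSubalgebra.toSubmodule)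
    ((VonNeumannAlgebra.isClosed_coe M).preimage (circleCalc_continuous v)) (fun n => ?_) g
  change circleCalc v _ ∈ M
  rw [circleCalc_monomial]
  obtain ⟨k, rfl | rfl⟩ := n.eq_nat_or_neg
  · simpa using pow_mem hv k
  · rw [zpow_neg, zpow_natCast, ← Unitary.star_eq_inv]
    simpa using pow_mem hvs k

end Unitary

/-! ### The density theorem in the amplification `ℓ²(ι; H)` -/

section Amplification

variable {H : Type w} [NormedAddCommGroup H] [InnerProductSpace ℂ H] [CompleteSpace H]

/-- The diagonal action `(ζᵢ) ↦ (a ζᵢ)` of an operator `a` on `ℓ²(ι; H)`. -/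
noncomputable def amplify (ι : Type*) (a : H →L[ℂ] H) :
    lp (fun _ : ι => H) 2 →L[ℂ] lp (fun _ : ι => H) 2 :=
  LinearMap.mkContinuous
    { toFun := fun ζ => ⟨fun i => a (ζ i), by
        have h2 : (0 : ℝ) < (2 : ℝ≥0∞).toReal := by norm_num
        refine memℓp_gen (Summable.of_nonneg_of_le (fun i => by positivity) (fun i => ?_)
          (((memℓp_gen_iff h2).1 (lp.memℓp ζ)).mul_left (‖a‖ ^ (2 : ℝ≥0∞).toReal)))
        rw [← Real.mul_rpow (norm_nonneg _) (norm_nonneg _)]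
        exact Real.rpow_le_rpow (norm_nonneg _) (a.le_opNorm _) h2.le⟩
      map_add' := fun ζ η => by ext i; exact map_add a _ _
      map_smul' := fun c ζ => by ext i; exact map_smul a _ _ } ‖a‖ (fun ζ => by
        have h2 : (0 : ℝ) < (2 : ℝ≥0∞).toReal := by norm_num
        refine lp.norm_le_of_forall_sum_le h2 (by positivity) fun s => ?_
        rw [Real.mul_rpow (norm_nonneg _) (norm_nonneg _)]
        calc ∑ i ∈ s, ‖a (ζ i)‖ ^ (2 : ℝ≥0∞).toReal
            ≤ ∑ i ∈ s, ‖a‖ ^ (2 : ℝ≥0∞).toReal * ‖ζ i‖ ^ (2 : ℝ≥0∞).toReal := by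
              refine Finset.sum_le_sum fun i _ => ?_
              rw [← Real.mul_rpow (norm_nonneg _) (norm_nonneg _)]
              exact Real.rpow_le_rpow (norm_nonneg _) (a.le_opNorm _) h2.le
          _ ≤ _ := by
              rw [← Finset.mul_sum]
              exact mul_le_mul_of_nonneg_left (lp.sum_rpow_le_norm_rpow h2 ζ s) (by positivity))

omit [CompleteSpace H] in
@[simp]
theorem amplify_apply {ι : Type*} (a : H →L[ℂ] H) (ζ : lp (fun _ : ι => H) 2) (i : ι) :
    amplify ι a ζ i = a (ζ i) := rfl

omit [CompleteSpace H] in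
theorem amplify_single {ι : Type*} [DecidableEq ι] (a : H →L[ℂ] H) (i : ι) (η : H) :
    amplify ι a (lp.single 2 i η) = lp.single 2 i (a η) := by
  ext j
  rw [amplify_apply]
  by_cases h : j = i
  · subst h; simp
  · rw [lp.single_apply_ne _ _ _ h, lp.single_apply_ne _ _ _ h, map_zero]

theorem inner_amplify_star {ι : Type*} (a : H →L[ℂ] H) (ζ η : lp (fun _ : ι => H) 2) :
    ⟪amplify ι (star a) ζ, η⟫_ℂ = ⟪ζ, amplify ι a η⟫_ℂ := by
  rw [lp.inner_eq_tsum, lp.inner_eq_tsum]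
  refine tsum_congr fun i => ?_
  simp only [amplify_apply, ContinuousLinearMap.star_eq_adjoint]
  exact ContinuousLinearMap.adjoint_inner_left _ _ _

/-- **Density theorem.** An element of the bicommutant of a unital `⋆`-algebra `A` of operators is
approximated by elements of `A` in `ℓ²`-sum over a square summable family of vectors. The projection
onto the closure of `{(a ζᵢ) : a ∈ A}` commutes with the diagonal action of `A`, so its matrix
entries lie in the commutant of `A`. -/
theorem amplify_mem_closure {ι : Type*} (A : StarSubalgebra ℂ (H →L[ℂ] H)) {x : H →L[ℂ] H}
    (hx : x ∈ Set.centralizer (Set.centralizer (A : Set (H →L[ℂ] H))))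
    (ζ : lp (fun _ : ι => H) 2) :
    amplify ι x ζ ∈ closure ((fun a => amplify ι a ζ) '' (A : Set (H →L[ℂ] H))) := by
  classical
  let L : (H →L[ℂ] H) →ₗ[ℂ] lp (fun _ : ι => H) 2 :=
    { toFun := fun a => amplify ι a ζ
      map_add' := fun a b => by ext i; simp
      map_smul' := fun c a => by ext i; simp }
  let S : Submodule ℂ (lp (fun _ : ι => H) 2) := A.toSubalgebra.toSubmodule.map L
  let K := S.topologicalClosure
  have hKc : (K : Set (lp (fun _ : ι => H) 2)) =
      closure ((fun a => amplify ι a ζ) '' (A : Set (H →L[ℂ] H))) := rfl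
  have : CompleteSpace K := S.isClosed_topologicalClosure.completeSpace_coe
  have hmul : ∀ a b : H →L[ℂ] H, ∀ η, amplify ι a (amplify ι b η) = amplify ι (a * b) η :=
    fun a b η => by ext i; simp
  have hinv : ∀ a ∈ A, ∀ η ∈ K, amplify ι a η ∈ K := by
    intro a ha η hη
    have hSK : S ≤ K.comap (amplify ι a).toLinearMap := by
      rintro _ ⟨b, hb, rfl⟩
      refine S.le_topologicalClosure ⟨a * b, A.mul_mem ha hb, (hmul a b ζ).symm⟩
    exact closure_minimal hSK (S.isClosed_topologicalClosure.preimage (amplify ι a).continuous) hη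
  have hinv' : ∀ a ∈ A, ∀ η ∈ Kᗮ, amplify ι a η ∈ Kᗮ := by
    intro a ha η hη
    rw [Submodule.mem_orthogonal] at hη ⊢
    intro k hk
    rw [← inner_amplify_star]
    exact hη _ (hinv _ (star_mem ha) k hk)
  let P := K.starProjection
  have hcomm : ∀ a ∈ A, ∀ η, P (amplify ι a η) = amplify ι a (P η) := by
    intro a ha η
    refine (Submodule.eq_starProjection_of_mem_of_inner_eq_zero (hinv a ha _
      (K.starProjection_apply_mem η)) fun k hk => ?_)
    rw [← map_sub]
    have := hinv' a ha _ (K.sub_starProjection_mem_orthogonal η)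
    exact Submodule.inner_left_of_mem_orthogonal hk this
  -- the matrix entries of `P` lie in the commutant of `A`, hence commute with `x`
  have hentry : ∀ i j (η : H), (P (lp.single 2 j (x η)) : lp (fun _ : ι => H) 2) i =
      x ((P (lp.single 2 j η) : lp (fun _ : ι => H) 2) i) := by
    intro i j η
    let E : H →L[ℂ] H := (lp.evalCLM ℂ (fun _ : ι => H) 2 i).comp
      (P.comp (lp.singleContinuousLinearMap ℂ (fun _ : ι => H) 2 j))
    have hE : E ∈ Set.centralizer (A : Set (H →L[ℂ] H)) := by
      intro a ha
      ext η
      change a ((P (lp.single 2 j η) : lp (fun _ : ι => H) 2) i) =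
        (P (lp.single 2 j (a η)) : lp (fun _ : ι => H) 2) i
      rw [← amplify_single, hcomm a ha]; rfl
    exact (DFunLike.congr_fun (hx E hE) η)
  -- so `P` commutes with `x`, and `x ζ = x (P ζ) = P (x ζ)` lies in the closure
  have hPx : P.comp (amplify ι x) = (amplify ι x).comp P := by
    ext η i
    have h := lp.hasSum_single (p := 2) (by norm_num) η
    have h1 := h.mapL ((lp.evalCLM ℂ (fun _ : ι => H) 2 i).comp (P.comp (amplify ι x)))
    have h2 := h.mapL ((lp.evalCLM ℂ (fun _ : ι => H) 2 i).comp ((amplify ι x).comp P))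
    refine h1.unique ?_
    have hrfl : (fun j => (lp.evalCLM ℂ (fun _ : ι => H) 2 i).comp (P.comp (amplify ι x))
        (lp.single 2 j (η j))) = fun j => (lp.evalCLM ℂ (fun _ : ι => H) 2 i).comp
          ((amplify ι x).comp P) (lp.single 2 j (η j)) := ?_
    · rw [hrfl]; exact h2
    ext j
    change (P (amplify ι x (lp.single 2 j (η j))) : lp (fun _ : ι => H) 2) i = _
    rw [amplify_single, hentry]; rfl
  have hζ : ζ ∈ K := S.le_topologicalClosure ⟨1, one_mem A, by ext i; simp [L]⟩
  rw [← hKc]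
  have hPζ : P ζ = ζ := Submodule.starProjection_eq_self_iff.2 hζ
  have := DFunLike.congr_fun hPx ζ
  simp only [ContinuousLinearMap.comp_apply, hPζ] at this
  rw [← this]
  exact K.starProjection_apply_mem _

/-- The density theorem for a square summable family of vectors, written as a bound for a sum. -/
theorem exists_mem_tsum_norm_sub_sq_lt {ι : Type*} (A : StarSubalgebra ℂ (H →L[ℂ] H))
    {x : H →L[ℂ] H} (hx : x ∈ Set.centralizer (Set.centralizer (A : Set (H →L[ℂ] H))))
    (ζ : ι → H) (hζ : Summable fun i => ‖ζ i‖ ^ 2) {ε : ℝ} (hε : 0 < ε) :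
    ∃ a ∈ A, Summable (fun i => ‖(x - a) (ζ i)‖ ^ 2) ∧ ∑' i, ‖(x - a) (ζ i)‖ ^ 2 < ε := by
  have h2 : (0 : ℝ) < (2 : ℝ≥0∞).toReal := by norm_num
  let ζ' : lp (fun _ : ι => H) 2 := ⟨ζ, memℓp_gen (by simpa using hζ)⟩
  obtain ⟨_, ⟨a, ha, rfl⟩, hd⟩ := Metric.mem_closure_iff.1 (amplify_mem_closure A hx ζ')
    (√ε) (Real.sqrt_pos.2 hε)
  have hs := lp.hasSum_norm h2 (amplify ι x ζ' - amplify ι a ζ')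
  have hs' : HasSum (fun i => ‖(x - a) (ζ i)‖ ^ 2) (‖amplify ι x ζ' - amplify ι a ζ'‖ ^ 2) := by
    simpa using hs
  refine ⟨a, ha, hs'.summable, ?_⟩
  rw [hs'.tsum_eq, ← dist_eq_norm]
  calc _ < √ε ^ 2 := by gcongr
    _ = ε := Real.sq_sqrt hε.le

end Amplification

/-! ### The Hilbert space `L²(M, τ)` -/

namespace VonNeumannAlgebra

variable {H : Type w} [NormedAddCommGroup H] [InnerProductSpace ℂ H] [CompleteSpace H]
  {M : VonNeumannAlgebra H}

/-- The canonical map `x ↦ x̂` from `M` to `L²(M, τ)`. -/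
noncomputable def gnsHat (τ : M →ₚ[ℂ] ℂ) : M →ₗ[ℂ] τ.GNS :=
  (UniformSpace.Completion.toComplₗᵢ (𝕜 := ℂ) (E := τ.PreGNS)).toLinearMap ∘ₗ
    τ.toPreGNS.toLinearMap

theorem gnsHat_denseRange (τ : M →ₚ[ℂ] ℂ) : DenseRange (gnsHat τ) :=
  UniformSpace.Completion.denseRange_coe (α := τ.PreGNS)

theorem inner_gnsHat (τ : M →ₚ[ℂ] ℂ) (x y : M) :
    ⟪gnsHat τ x, gnsHat τ y⟫_ℂ = τ (star x * y) :=
  UniformSpace.Completion.inner_coe (𝕜 := ℂ) (E := τ.PreGNS) _ _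

theorem gnsStarAlgHom_gnsHat (τ : M →ₚ[ℂ] ℂ) (x y : M) :
    τ.gnsStarAlgHom x (gnsHat τ y) = gnsHat τ (x * y) :=
  τ.gnsNonUnitalStarAlgHom_apply_coe (a := x) (b := τ.toPreGNS y)

theorem norm_gnsHat_sq (τ : M →ₚ[ℂ] ℂ) (x : M) : ((‖gnsHat τ x‖ ^ 2 : ℝ) : ℂ) = τ (star x * x) := by
  rw [← inner_gnsHat, inner_self_eq_norm_sq_to_K]; push_cast; rfl

/-- A positive functional is norm continuous. -/
theorem continuous_functional (τ : M →ₚ[ℂ] ℂ) : Continuous τ := by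
  obtain ⟨C, hC⟩ := τ.exists_norm_apply_le
  exact AddMonoidHomClass.continuous_of_bound τ C hC

section Trace

variable {τ : M →ₚ[ℂ] ℂ}

theorem IsTrace.gnsHat_injective (hτ : IsTrace τ) : Function.Injective (gnsHat τ) := by
  rw [injective_iff_map_eq_zero]
  intro x hx
  refine hτ.faithful x ?_
  rw [← norm_gnsHat_sq, hx]; simp

theorem IsTrace.inner_gnsHat_mul_right (hτ : IsTrace τ) (x y z : M) :
    ⟪gnsHat τ (x * z), gnsHat τ (y * z)⟫_ℂ = ⟪gnsHat τ x, gnsHat τ (y * (z * star z))⟫_ℂ := by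
  rw [inner_gnsHat, inner_gnsHat, star_mul, mul_assoc, hτ.tracial]
  simp only [mul_assoc]

theorem summable_sum_type {f : ℕ ⊕ ℕ → ℝ} (hf : Summable f) :
    Summable (fun n => f (Sum.inl n)) ∧ Summable (fun n => f (Sum.inr n)) ∧
      ∑' i, f i = ∑' n, f (Sum.inl n) + ∑' n, f (Sum.inr n) := by
  have h1 : Summable (f ∘ Sum.inl) := hf.comp_injective Sum.inl_injective
  have h2 : Summable (f ∘ Sum.inr) := hf.comp_injective Sum.inr_injective
  exact ⟨h1, h2, Summable.tsum_sum h1 h2⟩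

/-- Normality, in the form of an `L²`-estimate: the `2`-norm is dominated by an `ℓ²`-sum over a
square summable family of vectors of `H`. -/
theorem IsTrace.exists_norm_gnsHat_sq_le (hτ : IsTrace τ) : ∃ ζ : ℕ ⊕ ℕ → H,
    Summable (fun i => ‖ζ i‖ ^ 2) ∧ ∀ x : M,
      Summable (fun i => ‖(x : H →L[ℂ] H) (ζ i)‖ ^ 2) →
      ‖gnsHat τ x‖ ^ 2 ≤ ∑' i, ‖(x : H →L[ℂ] H) (ζ i)‖ ^ 2 := by
  obtain ⟨ξ, η, hξ, hη, h⟩ := hτ.normal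
  refine ⟨Sum.elim ξ η, ?_, fun x hx => ?_⟩
  · exact Summable.sum (f := fun i => ‖Sum.elim ξ η i‖ ^ 2) hξ hη
  · obtain ⟨h1, h2, h12⟩ := summable_sum_type hx
    simp only [Sum.elim_inl, Sum.elim_inr] at h1 h2 h12
    have hs := h (star x * x)
    rw [← norm_gnsHat_sq] at hs
    have hb : ∀ n, ‖⟪ξ n, ((star x * x : M) : H →L[ℂ] H) (η n)⟫_ℂ‖ ≤
        ‖(x : H →L[ℂ] H) (ξ n)‖ ^ 2 + ‖(x : H →L[ℂ] H) (η n)‖ ^ 2 := by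
      intro n
      have : ⟪ξ n, ((star x * x : M) : H →L[ℂ] H) (η n)⟫_ℂ =
          ⟪(x : H →L[ℂ] H) (ξ n), (x : H →L[ℂ] H) (η n)⟫_ℂ :=
        ContinuousLinearMap.adjoint_inner_right (x : H →L[ℂ] H) _ _
      rw [this]
      refine (norm_inner_le_norm _ _).trans ?_
      nlinarith [sq_nonneg (‖(x : H →L[ℂ] H) (ξ n)‖ - ‖(x : H →L[ℂ] H) (η n)‖),
        sq_nonneg ‖(x : H →L[ℂ] H) (ξ n)‖, sq_nonneg ‖(x : H →L[ℂ] H) (η n)‖]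
    have := tsum_of_norm_bounded (h1.add h2).hasSum hb
    rw [hs.tsum_eq, Complex.norm_real, Real.norm_of_nonneg (by positivity)] at this
    refine this.trans (le_of_eq ?_)
    rw [h1.tsum_add h2, h12]

/-- A unital `⋆`-algebra whose bicommutant is `M` is dense in `L²(M, τ)`. -/
theorem IsTrace.gnsHat_mem_closure (hτ : IsTrace τ) (A : StarSubalgebra ℂ (H →L[ℂ] H))
    (hA : Set.centralizer (Set.centralizer (A : Set (H →L[ℂ] H))) = M) (ψ : τ.GNS) :
    ψ ∈ closure (gnsHat τ '' {a : M | (a : H →L[ℂ] H) ∈ A}) := by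
  obtain ⟨ζ, hζ, hle⟩ := hτ.exists_norm_gnsHat_sq_le
  have hAM : ∀ a ∈ A, a ∈ M := fun a ha => by
    rw [← SetLike.mem_coe, ← hA]
    exact Set.subset_centralizer_centralizer ha
  have key : Set.range (gnsHat τ) ⊆ closure (gnsHat τ '' {a : M | (a : H →L[ℂ] H) ∈ A}) := by
    rintro _ ⟨x, rfl⟩
    rw [Metric.mem_closure_iff]
    intro ε hε
    have hx : (x : H →L[ℂ] H) ∈ Set.centralizer (Set.centralizer (A : Set (H →L[ℂ] H))) := by
      rw [hA]; exact x.2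
    obtain ⟨a, ha, hs, hlt⟩ := exists_mem_tsum_norm_sub_sq_lt A hx ζ hζ (pow_pos hε 2)
    refine ⟨_, ⟨⟨a, hAM a ha⟩, ha, rfl⟩, ?_⟩
    rw [dist_eq_norm, ← map_sub]
    refine lt_of_pow_lt_pow_left₀ 2 hε.le (lt_of_le_of_lt ?_ hlt)
    have hco : ((x - ⟨a, hAM a ha⟩ : M) : H →L[ℂ] H) = x - a := AddSubgroupClass.coe_sub _ _
    have := hle (x - ⟨a, hAM a ha⟩)
    rw [hco] at this
    exact this hs
  have := closure_minimal key isClosed_closure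
  exact this (gnsHat_denseRange τ ψ)

/-- On bounded sets, strong convergence of operators in `M` implies convergence in `2`-norm. -/
theorem IsTrace.tendsto_norm_gnsHat_sub (hτ : IsTrace τ) {x : ℕ → M} {y : M} {C : ℝ}
    (hC : ∀ k, ‖(x k : H →L[ℂ] H)‖ ≤ C)
    (hlim : ∀ ξ : H, Tendsto (fun k => (x k : H →L[ℂ] H) ξ) atTop (𝓝 ((y : H →L[ℂ] H) ξ))) :
    Tendsto (fun k => ‖gnsHat τ (x k - y)‖ ^ 2) atTop (𝓝 0) := by
  obtain ⟨ζ, hζ, hle⟩ := hτ.exists_norm_gnsHat_sq_le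
  let D := C + ‖(y : H →L[ℂ] H)‖
  have hb : ∀ k i, ‖((x k - y : M) : H →L[ℂ] H) (ζ i)‖ ^ 2 ≤ D ^ 2 * ‖ζ i‖ ^ 2 := by
    intro k i
    rw [← mul_pow]
    refine pow_le_pow_left₀ (norm_nonneg _) (((x k - y : M) : H →L[ℂ] H).le_of_opNorm_le ?_ _) 2
    exact (norm_sub_le _ _).trans (add_le_add_left (hC k) _)
  have hsum : ∀ k, Summable fun i => ‖((x k - y : M) : H →L[ℂ] H) (ζ i)‖ ^ 2 := fun k =>
    Summable.of_nonneg_of_le (fun i => by positivity) (hb k) (hζ.mul_left _)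
  have ht : Tendsto (fun k => ∑' i, ‖((x k - y : M) : H →L[ℂ] H) (ζ i)‖ ^ 2) atTop (𝓝 0) := by
    have := tendsto_tsum_of_dominated_convergence (𝓕 := atTop) (g := fun _ => (0 : ℝ))
      (f := fun k i => ‖((x k - y : M) : H →L[ℂ] H) (ζ i)‖ ^ 2) (hζ.mul_left (D ^ 2))
      (fun i => ?_) (Eventually.of_forall fun k i => by
        rw [Real.norm_of_nonneg (by positivity)]; exact hb k i)
    · simpa using this
    · have h := ((hlim (ζ i)).sub_const ((y : H →L[ℂ] H) (ζ i))).norm.pow 2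
      simpa using h
  exact squeeze_zero (fun k => by positivity) (fun k => hle _ (hsum k)) ht

end Trace

/-! ### Restriction of a trace to a subalgebra -/

theorem IsTrace.restrict {N : VonNeumannAlgebra H} {τ : M →ₚ[ℂ] ℂ} (hτ : IsTrace τ) (h : N ≤ M) :
    IsTrace (restrict h τ) where
  map_one := hτ.map_one
  tracial x y := hτ.tracial (incl h x) (incl h y)
  faithful x hx := by
    have := hτ.faithful (incl h x) hx
    exact Subtype.ext (congrArg (fun y : M => (y : H →L[ℂ] H)) this)
  normal := by
    obtain ⟨ξ, η, h1, h2, h3⟩ := hτ.normal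
    exact ⟨ξ, η, h1, h2, fun x => h3 (incl h x)⟩

end VonNeumannAlgebra

/-! ### Lebesgue measure on the circle -/

instance : IsProbabilityMeasure circleMeasure :=
  Measure.isProbabilityMeasure_map AddCircle.continuous_toCircle.aemeasurable

theorem integral_circleMonomial {n : ℤ} (hn : n ≠ 0) :
    ∫ z : Circle, ((z ^ n : Circle) : ℂ) ∂circleMeasure = 0 := by
  have : Fact ((0 : ℝ) < 1) := ⟨one_pos⟩
  have h := integral_map (μ := AddCircle.haarAddCircle (T := (1 : ℝ)))
    AddCircle.continuous_toCircle.aemeasurable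
    (circleMonomial n).continuous.aestronglyMeasurable (f := circleMonomial n)
  refine Eq.trans h ?_
  have h2 : ∀ x : AddCircle (1 : ℝ), circleMonomial n (AddCircle.toCircle x) = fourier n x := by
    intro x
    rw [fourier_apply, AddCircle.toCircle_zsmul, circleMonomial_apply]
  simp only [h2]
  exact integral_eq_zero_of_add_right_eq_neg (fourier_add_half_inv_index hn one_pos)

/-- Normalized Lebesgue measure is invariant under rotations, as rotations multiply the moments by
scalars. -/
theorem measurePreserving_circle_mul (c : Circle) :
    MeasurePreserving (fun z => c * z) circleMeasure circleMeasure := by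
  have hm : Measurable fun z : Circle => c * z := (continuous_const_mul c).measurable
  refine ⟨hm, ?_⟩
  have : IsProbabilityMeasure (Measure.map (fun z => c * z) circleMeasure) :=
    Measure.isProbabilityMeasure_map hm.aemeasurable
  refine circle_measure_ext fun n => ?_
  rcases eq_or_ne n 0 with rfl | hn
  · simp
  · have h := integral_map (μ := circleMeasure) hm.aemeasurable
      (circleMonomial n).continuous.aestronglyMeasurable (f := circleMonomial n)
    refine Eq.trans h ?_
    simp only [circleMonomial_apply, mul_zpow, Circle.coe_mul, integral_const_mul,
      integral_circleMonomial hn, mul_zero]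

section Unitary

variable {H : Type w} [NormedAddCommGroup H] [InnerProductSpace ℂ H] [CompleteSpace H]

/-! ### Strong limits in the functional calculus -/

theorem norm_circleCalc_le (v : unitary (H →L[ℂ] H)) (g : C(Circle, ℂ)) :
    ‖circleCalc v g‖ ≤ ‖g‖ :=
  NonUnitalStarAlgHom.norm_apply_le (circleCalc v) g

/-- If a uniformly bounded sequence of continuous functions converges almost everywhere for every
spectral measure of `v`, then the corresponding operators converge strongly. -/
theorem exists_strong_limit (v : unitary (H →L[ℂ] H)) {g : ℕ → C(Circle, ℂ)} {C : ℝ}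
    (hC : ∀ k, ‖g k‖ ≤ C) {f : Circle → ℂ}
    (hf : ∀ ξ, ∀ᵐ z ∂(spectralMeasure v ξ), Tendsto (fun k => g k z) atTop (𝓝 (f z))) :
    ∃ T : H →L[ℂ] H, ∀ ξ, Tendsto (fun k => circleCalc v (g k) ξ) atTop (𝓝 (T ξ)) := by
  have hC0 : 0 ≤ C := (norm_nonneg _).trans (hC 0)
  have hcauchy : ∀ ξ, CauchySeq fun k => circleCalc v (g k) ξ := by
    intro ξ
    rw [cauchySeq_iff_tendsto_dist_atTop_0]
    have h0 : Tendsto (fun p : ℕ × ℕ => ∫ z, ‖(g p.1 - g p.2) z‖ ^ 2 ∂(spectralMeasure v ξ)) atTop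
        (𝓝 (∫ _, (0 : ℝ) ∂(spectralMeasure v ξ))) := by
      refine tendsto_integral_filter_of_dominated_convergence (fun _ => (2 * C) ^ 2)
        (Eventually.of_forall fun p => ?_) (Eventually.of_forall fun p => ?_)
        (integrable_const _) ?_
      · exact (by fun_prop : Continuous fun z => ‖(g p.1 - g p.2) z‖ ^ 2).aestronglyMeasurable
      · refine Eventually.of_forall fun z => ?_
        rw [Real.norm_of_nonneg (by positivity)]
        refine pow_le_pow_left₀ (norm_nonneg _) ?_ 2
        refine ((g p.1 - g p.2).norm_coe_le_norm z).trans ((norm_sub_le _ _).trans ?_)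
        linarith [hC p.1, hC p.2]
      · filter_upwards [hf ξ] with z hz
        have h1 : Tendsto (fun p : ℕ × ℕ => g p.1 z) atTop (𝓝 (f z)) := by
          rw [← prod_atTop_atTop_eq]; exact hz.comp tendsto_fst
        have h2 : Tendsto (fun p : ℕ × ℕ => g p.2 z) atTop (𝓝 (f z)) := by
          rw [← prod_atTop_atTop_eq]; exact hz.comp tendsto_snd
        simpa using (h1.sub h2).norm.pow 2
    have hd : ∀ p : ℕ × ℕ, dist (circleCalc v (g p.1) ξ) (circleCalc v (g p.2) ξ) =
        √(∫ z, ‖(g p.1 - g p.2) z‖ ^ 2 ∂(spectralMeasure v ξ)) := by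
      intro p
      rw [← norm_circleCalc_apply_sq, map_sub, Real.sqrt_sq (norm_nonneg _), dist_eq_norm]
      rfl
    rw [show (fun p : ℕ × ℕ => dist (circleCalc v (g p.1) ξ) (circleCalc v (g p.2) ξ)) = _ from
      funext hd]
    simpa using h0.sqrt
  choose T hT using fun ξ => cauchySeq_tendsto_of_complete (hcauchy ξ)
  refine ⟨LinearMap.mkContinuous
    { toFun := T
      map_add' := fun ξ η => tendsto_nhds_unique (hT _) (by simpa using (hT ξ).add (hT η))
      map_smul' := fun c ξ => tendsto_nhds_unique (hT _) (by simpa using (hT ξ).const_smul c) } C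
    fun ξ => ?_, hT⟩
  exact le_of_tendsto (hT ξ).norm (Eventually.of_forall fun k =>
    (circleCalc v (g k)).le_of_opNorm_le ((norm_circleCalc_le v _).trans (hC k)) ξ)

/-- Von Neumann algebras are closed under pointwise (strong) limits of operators. -/
theorem VonNeumannAlgebra.mem_of_strong_tendsto (M : VonNeumannAlgebra H) {x : ℕ → H →L[ℂ] H}
    (hx : ∀ k, x k ∈ M) {T : H →L[ℂ] H} (hT : ∀ ξ, Tendsto (fun k => x k ξ) atTop (𝓝 (T ξ))) :
    T ∈ M := by
  rw [← VonNeumannAlgebra.commutant_commutant M, VonNeumannAlgebra.mem_commutant_iff]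
  intro y hy
  ext ξ
  refine tendsto_nhds_unique (((y.continuous.tendsto _).comp (hT ξ))) ?_
  refine (hT (y ξ)).congr fun k => ?_
  have := VonNeumannAlgebra.mem_commutant_iff.1 hy (x k) (hx k)
  exact DFunLike.congr_fun this ξ

/-! ### Absolute continuity of the spectral measures -/

section Trace

open VonNeumannAlgebra

variable {M : VonNeumannAlgebra H} {τ : M →ₚ[ℂ] ℂ} {v : unitary (H →L[ℂ] H)}

/-- If the powers of `v` have trace zero, then the distribution of `v` is Lebesgue measure. -/
theorem trace_circleCalc (hτ : IsTrace τ) (hv : (v : H →L[ℂ] H) ∈ M)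
    (hmom : ∀ (n : ℤ) (x : M), n ≠ 0 → (x : H →L[ℂ] H) = ((v ^ n : unitary _) : H →L[ℂ] H) →
      τ x = 0) (g : C(Circle, ℂ)) :
    τ ⟨circleCalc v g, circleCalc_mem M hv g⟩ = ∫ z, g z ∂circleMeasure := by
  let F : C(Circle, ℂ) →L[ℂ] ℂ :=
    { toFun := fun g => τ ⟨circleCalc v g, circleCalc_mem M hv g⟩
      map_add' := fun g h => by
        rw [← map_add]; congr 1; exact Subtype.ext (map_add _ _ _)
      map_smul' := fun c g => by
        rw [RingHom.id_apply, ← map_smul]; congr 1; exact Subtype.ext (map_smul _ _ _)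
      cont := (continuous_functional τ).comp
        ((circleCalc_continuous v).subtype_mk (fun g => circleCalc_mem M hv g)) }
  have : F = circleIntegralCLM circleMeasure := by
    refine eq_of_forall_circleMonomial fun n => ?_
    rcases eq_or_ne n 0 with rfl | hn
    · change τ ⟨circleCalc v (circleMonomial 0), _⟩ = _
      have h1 : (⟨circleCalc v (circleMonomial 0), circleCalc_mem M hv _⟩ : M) = 1 :=
        Subtype.ext (by
          change circleCalc v (circleMonomial 0) = 1
          rw [circleMonomial_zero, map_one])
      rw [h1, hτ.map_one]
      simp
    · refine (hmom n _ hn (circleCalc_monomial v n)).trans ?_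
      exact (integral_circleMonomial hn).symm
  exact DFunLike.congr_fun this g

/-- The spectral measures of `v` do not charge closed Lebesgue-null sets `K`: the indicator function
of `K` is a bounded limit of continuous functions, and the strong limit of the corresponding
operators has `2`-norm zero. -/
theorem spectralMeasure_isClosed_eq_zero (hτ : IsTrace τ) (hv : (v : H →L[ℂ] H) ∈ M)
    (hmom : ∀ (n : ℤ) (x : M), n ≠ 0 → (x : H →L[ℂ] H) = ((v ^ n : unitary _) : H →L[ℂ] H) →
      τ x = 0) (ξ : H) {K : Set Circle} (hK : IsClosed K) (hK0 : circleMeasure K = 0) :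
    spectralMeasure v ξ K = 0 := by
  have hpos : ∀ n : ℕ, (0 : ℝ) < 1 / ((n : ℝ) + 1) := fun n => Nat.one_div_pos_of_nat
  let t : ℕ → Circle → ℂ := fun k z => ((thickenedIndicator (hpos k) K z : NNReal) : ℝ)
  let g : ℕ → C(Circle, ℂ) := fun k => ⟨t k, by
    have := (thickenedIndicator (hpos k) K).continuous
    fun_prop⟩
  have hle : ∀ k, ‖g k‖ ≤ 1 := fun k => (ContinuousMap.norm_le _ zero_le_one).2 fun z => by
    change ‖(((thickenedIndicator (hpos k) K z : NNReal) : ℝ) : ℂ)‖ ≤ 1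
    rw [Complex.norm_real, Real.norm_of_nonneg (NNReal.coe_nonneg _)]
    exact_mod_cast thickenedIndicator_le_one (hpos k) K z
  have hlim : ∀ z, Tendsto (fun k => g k z) atTop (𝓝 (K.indicator (fun _ => (1 : ℂ)) z)) := by
    intro z
    have h := tendsto_pi_nhds.1 (thickenedIndicator_tendsto_indicator_closure hpos
      tendsto_one_div_add_atTop_nhds_zero_nat K) z
    rw [hK.closure_eq] at h
    have h2 : Tendsto (fun k => g k z) atTop
        (𝓝 (((K.indicator (fun _ => (1 : NNReal)) z : NNReal) : ℝ) : ℂ)) :=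
      ((Complex.continuous_ofReal.comp NNReal.continuous_coe).tendsto _).comp h
    convert h2 using 2
    by_cases hz : z ∈ K <;> simp [hz]
  have hint : ∀ (μ : Measure Circle) [IsFiniteMeasure μ],
      Tendsto (fun k => ∫ z, g k z ∂μ) atTop (𝓝 ((μ.real K : ℝ) : ℂ)) := by
    intro μ _
    have h := tendsto_integral_of_dominated_convergence (μ := μ) (fun _ => (1 : ℝ))
      (fun k => (g k).continuous.aestronglyMeasurable) (integrable_const _)
      (fun k => Eventually.of_forall fun z => ((g k).norm_coe_le_norm z).trans (hle k))
      (Eventually.of_forall hlim)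
    rwa [integral_indicator_const _ hK.measurableSet, Complex.real_smul, mul_one] at h
  obtain ⟨T, hT⟩ := exists_strong_limit v hle (fun ξ => Eventually.of_forall hlim)
  have hTM : T ∈ M := M.mem_of_strong_tendsto (fun k => circleCalc_mem M hv (g k)) hT
  let x : ℕ → M := fun k => ⟨circleCalc v (g k), circleCalc_mem M hv (g k)⟩
  have h1 := hτ.tendsto_norm_gnsHat_sub (x := x) (y := ⟨T, hTM⟩) (C := 1)
    (fun k => (norm_circleCalc_le v _).trans (hle k)) hT
  have hmK : Tendsto (fun k => ∫ z, ‖g k z‖ ^ 2 ∂circleMeasure) atTop (𝓝 0) := by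
    have h := tendsto_integral_of_dominated_convergence (μ := circleMeasure) (fun _ => (1 : ℝ))
      (F := fun k z => ‖g k z‖ ^ 2) (f := fun _ => 0)
      (fun k => (by fun_prop : Continuous fun z => ‖g k z‖ ^ 2).aestronglyMeasurable)
      (integrable_const _)
      (fun k => Eventually.of_forall fun z => by
        rw [Real.norm_of_nonneg (by positivity)]
        exact pow_le_one₀ (norm_nonneg _) (((g k).norm_coe_le_norm z).trans (hle k))) ?_
    · simpa using h
    · filter_upwards [measure_eq_zero_iff_ae_notMem.1 hK0] with z hz
      simpa [hz] using (hlim z).norm.pow 2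
  have h2 : ∀ k, ‖gnsHat τ (x k)‖ ^ 2 = ∫ z, ‖g k z‖ ^ 2 ∂circleMeasure := by
    intro k
    have h := trace_circleCalc hτ hv hmom (star (g k) * g k)
    have e : (⟨circleCalc v (star (g k) * g k), circleCalc_mem M hv _⟩ : M) = star (x k) * x k :=
      Subtype.ext (by
        change circleCalc v (star (g k) * g k) = star (circleCalc v (g k)) * circleCalc v (g k)
        rw [map_mul, map_star])
    have h3 : ∀ z, (star (g k) * g k) z = ((‖g k z‖ ^ 2 : ℝ) : ℂ) := fun z => by
      simp [← Complex.normSq_eq_conj_mul_self, Complex.normSq_eq_norm_sq]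
    rw [e, ← norm_gnsHat_sq] at h
    simp only [h3, integral_complex_ofReal] at h
    exact Complex.ofReal_injective h
  have hT0 : T = 0 := by
    have ha : Tendsto (fun k => ‖gnsHat τ (x k)‖) atTop (𝓝 0) := by
      have := hmK.sqrt
      simp only [← h2, Real.sqrt_sq (norm_nonneg _), Real.sqrt_zero] at this
      exact this
    have hb : Tendsto (fun k => ‖gnsHat τ (x k - ⟨T, hTM⟩)‖) atTop (𝓝 0) := by
      have := h1.sqrt
      simp only [Real.sqrt_sq (norm_nonneg _), Real.sqrt_zero] at this
      exact this
    have hz : ‖gnsHat τ ⟨T, hTM⟩‖ ≤ 0 := by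
      have hab := ha.add hb
      rw [add_zero] at hab
      refine ge_of_tendsto hab (Eventually.of_forall fun k => ?_)
      calc ‖gnsHat τ ⟨T, hTM⟩‖ = ‖gnsHat τ (x k) - gnsHat τ (x k - ⟨T, hTM⟩)‖ := by
            rw [map_sub, sub_sub_cancel]
        _ ≤ ‖gnsHat τ (x k)‖ + ‖gnsHat τ (x k - ⟨T, hTM⟩)‖ := norm_sub_le _ _
    have := hτ.gnsHat_injective ((norm_le_zero_iff.1 hz).trans (map_zero (gnsHat τ)).symm)
    exact congrArg (fun y : M => (y : H →L[ℂ] H)) this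
  have hfin := hint (spectralMeasure v ξ)
  simp only [integral_spectralMeasure] at hfin
  have hzero : Tendsto (fun k => ⟪ξ, circleCalc v (g k) ξ⟫_ℂ) atTop (𝓝 0) := by
    have := (tendsto_const_nhds (x := ξ)).inner (𝕜 := ℂ) (hT ξ)
    simpa [hT0] using this
  have := tendsto_nhds_unique hfin hzero
  rw [← measureReal_eq_zero_iff]
  exact_mod_cast this

theorem spectralMeasure_absolutelyContinuous (hτ : IsTrace τ) (hv : (v : H →L[ℂ] H) ∈ M)
    (hmom : ∀ (n : ℤ) (x : M), n ≠ 0 → (x : H →L[ℂ] H) = ((v ^ n : unitary _) : H →L[ℂ] H) →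
      τ x = 0) (ξ : H) : spectralMeasure v ξ ≪ circleMeasure := by
  refine Measure.AbsolutelyContinuous.mk fun s hs h0 => ?_
  rw [hs.measure_eq_iSup_isClosed_of_ne_top (measure_ne_top _ _)]
  simp only [ENNReal.iSup_eq_zero]
  exact fun K hKs hK => spectralMeasure_isClosed_eq_zero hτ hv hmom ξ hK (measure_mono_null hKs h0)

end Trace

end Unitary

/-! ### The `L^∞` functional calculus -/

section LinftyCalculus

variable {H : Type w} [NormedAddCommGroup H] [InnerProductSpace ℂ H] [CompleteSpace H]

/-- The scalar unitary operators. -/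
noncomputable def scalarUnitary (H : Type w) [NormedAddCommGroup H] [InnerProductSpace ℂ H]
    [CompleteSpace H] : Circle →* unitary (H →L[ℂ] H) where
  toFun c := ⟨(c : ℂ) • 1, by
    have h : (starRingEnd ℂ) (c : ℂ) * c = 1 := by
      rw [← Circle.coe_inv_eq_conj, ← Circle.coe_mul, inv_mul_cancel, Circle.coe_one]
    constructor
    · rw [star_smul, star_one, smul_mul_smul_comm, mul_one]
      exact (congrArg (· • (1 : H →L[ℂ] H)) h).trans (one_smul _ _)
    · rw [star_smul, star_one, smul_mul_smul_comm, mul_one, mul_comm]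
      exact (congrArg (· • (1 : H →L[ℂ] H)) h).trans (one_smul _ _)⟩
  map_one' := Subtype.ext (by simp)
  map_mul' c d := Subtype.ext (by simp [mul_smul, smul_comm (d : ℂ)])

@[simp]
theorem coe_scalarUnitary (c : Circle) :
    (scalarUnitary H c : H →L[ℂ] H) = (c : ℂ) • 1 := rfl

theorem scalarUnitary_comm (c : Circle) (x : unitary (H →L[ℂ] H)) :
    Commute (scalarUnitary H c) x := Subtype.ext (by simp)

/-- If `U` rotates `v`, then conjugation by `U` rotates the continuous functions of `v`. -/
theorem circleCalc_comp_rotation (v U : unitary (H →L[ℂ] H)) (c : Circle)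
    (hU : v * U = scalarUnitary H c * (U * v)) (g : C(Circle, ℂ)) :
    circleCalc v (g.comp ⟨fun z => c * z, continuous_const_mul c⟩) =
      star (U : H →L[ℂ] H) * circleCalc v g * U := by
  let R : C(Circle, ℂ) →L[ℂ] C(Circle, ℂ) :=
    { toFun := fun g => g.comp ⟨fun z => c * z, continuous_const_mul c⟩
      map_add' := fun _ _ => rfl
      map_smul' := fun _ _ => rfl
      cont := ContinuousMap.continuous_precomp _ }
  let F : C(Circle, ℂ) →L[ℂ] (H →L[ℂ] H) := (circleCalcCLM v).comp R
  let G : C(Circle, ℂ) →L[ℂ] (H →L[ℂ] H) :=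
    { toFun := fun g => star (U : H →L[ℂ] H) * circleCalc v g * U
      map_add' := fun a b => by simp [mul_add, add_mul]
      map_smul' := fun a b => by simp
      cont := (continuous_const.mul (circleCalc_continuous v)).mul continuous_const }
  have hFG : F = G := by
    refine eq_of_forall_circleMonomial fun n => ?_
    have h1 : (circleMonomial n).comp ⟨fun z => c * z, continuous_const_mul c⟩ =
        ((c ^ n : Circle) : ℂ) • circleMonomial n := by
      ext z; simp [mul_zpow]
    have h2 : U⁻¹ * v ^ n * U = scalarUnitary H (c ^ n) * v ^ n := by
      have h3 : U⁻¹ * v * U⁻¹⁻¹ = scalarUnitary H c * v := by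
        rw [inv_inv, mul_assoc, hU, ← mul_assoc, (scalarUnitary_comm c U⁻¹).symm.eq, mul_assoc,
          inv_mul_cancel_left]
      have h4 := conj_zpow (a := U⁻¹) (b := v) (i := n)
      rw [h3, inv_inv, (scalarUnitary_comm c v).mul_zpow, ← map_zpow] at h4
      exact h4.symm
    change circleCalc v ((circleMonomial n).comp _) = star (U : H →L[ℂ] H) * circleCalc v _ * U
    rw [h1, map_smul, circleCalc_monomial]
    have := congrArg (fun x : unitary (H →L[ℂ] H) => (x : H →L[ℂ] H)) h2
    simp only [Submonoid.coe_mul, coe_scalarUnitary, smul_mul_assoc, one_mul,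
      ← Unitary.star_eq_inv, Unitary.coe_star] at this
    exact this.symm
  exact DFunLike.congr_fun hFG g

/-- `T` is the strong limit of `gₖ(v)` for a uniformly bounded sequence of continuous functions
`gₖ` converging to `f` almost everywhere for Lebesgue measure. When the spectral measures of `v` are
absolutely continuous, this says that `T = f(v)`. -/
def IsLinftyCalc (v : unitary (H →L[ℂ] H)) (f : Circle → ℂ) (T : H →L[ℂ] H) : Prop :=
  ∃ (g : ℕ → C(Circle, ℂ)) (C : ℝ), (∀ k, ‖g k‖ ≤ C) ∧
    (∀ᵐ z ∂circleMeasure, Tendsto (fun k => g k z) atTop (𝓝 (f z))) ∧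
    ∀ ξ, Tendsto (fun k => circleCalc v (g k) ξ) atTop (𝓝 (T ξ))

variable {v : unitary (H →L[ℂ] H)} {f f' : Circle → ℂ} {T T' : H →L[ℂ] H}

theorem isLinftyCalc_circleCalc (v : unitary (H →L[ℂ] H)) (g : C(Circle, ℂ)) :
    IsLinftyCalc v g (circleCalc v g) :=
  ⟨fun _ => g, ‖g‖, fun _ => le_rfl, Eventually.of_forall fun _ => tendsto_const_nhds,
    fun _ => tendsto_const_nhds⟩

namespace IsLinftyCalc

theorem congr_ae (h : IsLinftyCalc v f T) (hff' : f =ᵐ[circleMeasure] f') :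
    IsLinftyCalc v f' T := by
  obtain ⟨g, C, hC, hg, hT⟩ := h
  refine ⟨g, C, hC, ?_, hT⟩
  filter_upwards [hg, hff'] with z hz hz'
  rwa [← hz']

theorem mem (h : IsLinftyCalc v f T) (M : VonNeumannAlgebra H) (hv : (v : H →L[ℂ] H) ∈ M) :
    T ∈ M := by
  obtain ⟨g, C, hC, hg, hT⟩ := h
  exact M.mem_of_strong_tendsto (fun k => circleCalc_mem M hv (g k)) hT

theorem sub (h : IsLinftyCalc v f T) (h' : IsLinftyCalc v f' T') :
    IsLinftyCalc v (fun z => f z - f' z) (T - T') := by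
  obtain ⟨g, C, hC, hg, hT⟩ := h
  obtain ⟨g', C', hC', hg', hT'⟩ := h'
  refine ⟨fun k => g k - g' k, C + C', fun k => (norm_sub_le _ _).trans
    (add_le_add (hC k) (hC' k)), ?_, fun ξ => ?_⟩
  · filter_upwards [hg, hg'] with z hz hz'
    exact hz.sub hz'
  · simpa using (hT ξ).sub (hT' ξ)

theorem add (h : IsLinftyCalc v f T) (h' : IsLinftyCalc v f' T') :
    IsLinftyCalc v (fun z => f z + f' z) (T + T') := by
  obtain ⟨g, C, hC, hg, hT⟩ := h
  obtain ⟨g', C', hC', hg', hT'⟩ := h'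
  refine ⟨fun k => g k + g' k, C + C', fun k => (norm_add_le _ _).trans
    (add_le_add (hC k) (hC' k)), ?_, fun ξ => ?_⟩
  · filter_upwards [hg, hg'] with z hz hz'
    exact hz.add hz'
  · simpa using (hT ξ).add (hT' ξ)

theorem const_smul (c : ℂ) (h : IsLinftyCalc v f T) :
    IsLinftyCalc v (fun z => c * f z) (c • T) := by
  obtain ⟨g, C, hC, hg, hT⟩ := h
  refine ⟨fun k => c • g k, ‖c‖ * C, fun k => ?_, ?_, fun ξ => ?_⟩
  · rw [norm_smul]; exact mul_le_mul_of_nonneg_left (hC k) (norm_nonneg _)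
  · filter_upwards [hg] with z hz
    exact hz.const_mul c
  · simpa using (hT ξ).const_smul c

theorem mul (h : IsLinftyCalc v f T) (h' : IsLinftyCalc v f' T') :
    IsLinftyCalc v (fun z => f z * f' z) (T * T') := by
  obtain ⟨g, C, hC, hg, hT⟩ := h
  obtain ⟨g', C', hC', hg', hT'⟩ := h'
  have hC0 : 0 ≤ C := (norm_nonneg _).trans (hC 0)
  refine ⟨fun k => g k * g' k, C * C', fun k => (norm_mul_le _ _).trans
    (mul_le_mul (hC k) (hC' k) (norm_nonneg _) hC0), ?_, fun ξ => ?_⟩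
  · filter_upwards [hg, hg'] with z hz hz'
    exact hz.mul hz'
  · have h1 : Tendsto (fun k => circleCalc v (g k) (T' ξ)) atTop (𝓝 (T (T' ξ))) := hT _
    have h2 : Tendsto (fun k => circleCalc v (g k) (circleCalc v (g' k) ξ - T' ξ)) atTop (𝓝 0) := by
      have h3 : Tendsto (fun k => C * ‖circleCalc v (g' k) ξ - T' ξ‖) atTop (𝓝 0) := by
        simpa using (tendsto_iff_norm_sub_tendsto_zero.1 (hT' ξ)).const_mul C
      refine squeeze_zero_norm (fun k => ?_) h3
      exact (circleCalc v (g k)).le_of_opNorm_le ((norm_circleCalc_le v _).trans (hC k)) _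
    have h4 := h1.add h2
    rw [add_zero] at h4
    refine h4.congr fun k => ?_
    rw [← map_add, add_sub_cancel, map_mul]; rfl

/-- Conjugation by a unitary that rotates `v` rotates the function. -/
theorem conj (h : IsLinftyCalc v f T) (U : unitary (H →L[ℂ] H)) (c : Circle)
    (hU : v * U = scalarUnitary H c * (U * v)) :
    IsLinftyCalc v (fun z => f (c * z)) (star (U : H →L[ℂ] H) * T * U) := by
  obtain ⟨g, C, hC, hg, hT⟩ := h
  let rot : C(Circle, Circle) := ⟨fun z => c * z, continuous_const_mul c⟩
  refine ⟨fun k => (g k).comp rot, C, fun k => ?_, ?_, fun ξ => ?_⟩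
  · exact (ContinuousMap.norm_le _ ((norm_nonneg _).trans (hC 0))).2 fun z =>
      ((g k).norm_coe_le_norm _).trans (hC k)
  · exact (measurePreserving_circle_mul c).quasiMeasurePreserving.ae hg
  · have h1 : Tendsto (fun k => star (U : H →L[ℂ] H) (circleCalc v (g k) ((U : H →L[ℂ] H) ξ)))
        atTop (𝓝 (star (U : H →L[ℂ] H) (T ((U : H →L[ℂ] H) ξ)))) :=
      ((star (U : H →L[ℂ] H)).continuous.tendsto _).comp (hT _)
    refine h1.congr fun k => ?_
    exact (DFunLike.congr_fun (circleCalc_comp_rotation v U c hU (g k)) ξ).symm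

section AbsolutelyContinuous

variable (hac : ∀ ξ, spectralMeasure v ξ ≪ circleMeasure)

include hac

theorem integrable_and_inner (h : IsLinftyCalc v f T) (ξ : H) :
    Integrable f (spectralMeasure v ξ) ∧ ⟪ξ, T ξ⟫_ℂ = ∫ z, f z ∂(spectralMeasure v ξ) := by
  obtain ⟨g, C, hC, hg, hT⟩ := h
  have hg' := (hac ξ).ae_le hg
  have hm : AEStronglyMeasurable f (spectralMeasure v ξ) :=
    aestronglyMeasurable_of_tendsto_ae atTop
      (fun k => (g k).continuous.aestronglyMeasurable) hg'
  refine ⟨Integrable.mono' (integrable_const C) hm ?_, ?_⟩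
  · filter_upwards [hg'] with z hz
    exact le_of_tendsto hz.norm (Eventually.of_forall fun k =>
      ((g k).norm_coe_le_norm z).trans (hC k))
  · have h1 := tendsto_integral_of_dominated_convergence (μ := spectralMeasure v ξ) (fun _ => C)
      (fun k => (g k).continuous.aestronglyMeasurable) (integrable_const _)
      (fun k => Eventually.of_forall fun z => ((g k).norm_coe_le_norm z).trans (hC k)) hg'
    simp only [integral_spectralMeasure] at h1
    exact tendsto_nhds_unique ((tendsto_const_nhds (x := ξ)).inner (𝕜 := ℂ) (hT ξ)) h1

theorem norm_sq (h : IsLinftyCalc v f T) (ξ : H) :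
    ‖T ξ‖ ^ 2 = ∫ z, ‖f z‖ ^ 2 ∂(spectralMeasure v ξ) := by
  obtain ⟨g, C, hC, hg, hT⟩ := h
  have hg' := (hac ξ).ae_le hg
  have h1 := tendsto_integral_of_dominated_convergence (μ := spectralMeasure v ξ) (fun _ => C ^ 2)
    (F := fun k z => ‖g k z‖ ^ 2) (f := fun z => ‖f z‖ ^ 2)
    (fun k => (by fun_prop : Continuous fun z => ‖g k z‖ ^ 2).aestronglyMeasurable)
    (integrable_const _)
    (fun k => Eventually.of_forall fun z => by
      rw [Real.norm_of_nonneg (by positivity)]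
      exact pow_le_pow_left₀ (norm_nonneg _) (((g k).norm_coe_le_norm z).trans (hC k)) 2)
    (by filter_upwards [hg'] with z hz using hz.norm.pow 2)
  simp only [← norm_circleCalc_apply_sq] at h1
  exact tendsto_nhds_unique ((hT ξ).norm.pow 2) h1

theorem unique (h : IsLinftyCalc v f T) (h' : IsLinftyCalc v f T') : T = T' := by
  ext ξ
  have := (h.sub h').norm_sq hac ξ
  simp only [sub_self, norm_zero, ne_eq, OfNat.ofNat_ne_zero, not_false_eq_true, zero_pow,
    integral_zero] at this
  exact sub_eq_zero.1 (norm_eq_zero.1 (pow_eq_zero_iff two_ne_zero |>.1 this))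

theorem isFunctionOf (h : IsLinftyCalc v f T) : IsFunctionOf v f T := fun ξ =>
  ⟨spectralMeasure v ξ, isSpectralMeasure_spectralMeasure v ξ,
    (h.integrable_and_inner hac ξ).1, (h.integrable_and_inner hac ξ).2⟩

theorem functionalCalculus_eq (h : IsLinftyCalc v f T) : functionalCalculus v f = T := by
  have hex : ∃ T, IsFunctionOf v f T := ⟨T, h.isFunctionOf hac⟩
  rw [functionalCalculus, dif_pos hex]
  have hs : ∀ ξ, ⟪ξ, hex.choose ξ⟫_ℂ = ⟪ξ, T ξ⟫_ℂ := by
    intro ξ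
    obtain ⟨μ, hμ, -, h1⟩ := hex.choose_spec ξ
    obtain ⟨ν, hν, -, h2⟩ := h.isFunctionOf hac ξ
    rw [h1, h2, hμ.unique hν]
  have := (ext_inner_map (hex.choose : H →ₗ[ℂ] H) (T : H →ₗ[ℂ] H)).1 fun ξ => by
    change ⟪hex.choose ξ, ξ⟫_ℂ = ⟪T ξ, ξ⟫_ℂ
    rw [← inner_conj_symm, ← inner_conj_symm (T ξ), hs]
  exact ContinuousLinearMap.coe_injective this

/-- The adjoint of `f(v)` is `f̄(v)`. The adjoints of `gₖ(v)` converge strongly by the same estimate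
as the `gₖ(v)`, although taking adjoints is not strongly continuous. -/
theorem adjoint (h : IsLinftyCalc v f T) : IsLinftyCalc v (fun z => star (f z)) (star T) := by
  obtain ⟨g, C, hC, hg, hT⟩ := h
  have hg' : ∀ᵐ z ∂circleMeasure, Tendsto (fun k => star (g k) z) atTop (𝓝 (star (f z))) := by
    filter_upwards [hg] with z hz using (continuous_star.tendsto _).comp hz
  obtain ⟨S, hS⟩ := exists_strong_limit v (g := fun k => star (g k)) (C := C)
    (fun k => (norm_star (g k)).trans_le (hC k)) (fun ξ => (hac ξ).ae_le hg')
  have hST : S = star T := by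
    rw [ContinuousLinearMap.star_eq_adjoint, ContinuousLinearMap.eq_adjoint_iff]
    intro ξ η
    have h1 := (hS ξ).inner (𝕜 := ℂ) (tendsto_const_nhds (x := η))
    have h2 := (tendsto_const_nhds (x := ξ)).inner (𝕜 := ℂ) (hT η)
    refine tendsto_nhds_unique h1 (h2.congr fun k => ?_)
    rw [map_star, ContinuousLinearMap.star_eq_adjoint, ContinuousLinearMap.adjoint_inner_left]
  exact hST ▸ ⟨fun k => star (g k), C, fun k => (norm_star (g k)).trans_le (hC k), hg', hS⟩

/-- Dominated convergence for the functional calculus. -/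
theorem tendsto_of_tendsto_ae {fk : ℕ → Circle → ℂ} {Tk : ℕ → H →L[ℂ] H}
    (hk : ∀ k, IsLinftyCalc v (fk k) (Tk k)) (h : IsLinftyCalc v f T) {C : ℝ}
    (hC : ∀ k, ∀ᵐ z ∂circleMeasure, ‖fk k z - f z‖ ≤ C)
    (hlim : ∀ᵐ z ∂circleMeasure, Tendsto (fun k => fk k z) atTop (𝓝 (f z))) (ξ : H) :
    Tendsto (fun k => Tk k ξ) atTop (𝓝 (T ξ)) := by
  rw [tendsto_iff_norm_sub_tendsto_zero]
  have h1 := tendsto_integral_of_dominated_convergence (μ := spectralMeasure v ξ) (fun _ => C ^ 2)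
    (F := fun k z => ‖fk k z - f z‖ ^ 2) (f := fun z => 0)
    (fun k => (((hk k).sub h).integrable_and_inner hac ξ).1.aestronglyMeasurable.norm.pow 2)
    (integrable_const _)
    (fun k => by
      filter_upwards [(hac ξ).ae_le (hC k)] with z hz
      rw [Real.norm_of_nonneg (by positivity)]
      exact pow_le_pow_left₀ (norm_nonneg _) hz 2)
    (by
      filter_upwards [(hac ξ).ae_le hlim] with z hz
      simpa using (tendsto_iff_norm_sub_tendsto_zero.1 hz).pow 2)
  have h2 : ∀ k, ∫ z, ‖fk k z - f z‖ ^ 2 ∂(spectralMeasure v ξ) = ‖Tk k ξ - T ξ‖ ^ 2 := fun k =>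
    (((hk k).sub h).norm_sq hac ξ).symm
  simp only [h2, integral_zero] at h1
  simpa [Real.sqrt_sq (norm_nonneg _)] using h1.sqrt

/-- If `f ≠ 0` almost everywhere, then `‖f(v) ξ‖² = ∫ |f|² dμ_ξ` vanishes only if `μ_ξ = 0`, that
is, if `ξ = 0`. -/
theorem injective_of_ne_zero (h : IsLinftyCalc v f T) (h0 : circleMeasure {z | f z = 0} = 0)
    {ξ : H} (hξ : T ξ = 0) : ξ = 0 := by
  have h1 := h.norm_sq hac ξ
  have hae : ∀ᵐ z ∂(spectralMeasure v ξ), f z ≠ 0 :=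
    (hac ξ).ae_le (measure_eq_zero_iff_ae_notMem.1 h0)
  have hint : Integrable (fun z => ‖f z‖ ^ 2) (spectralMeasure v ξ) := by
    obtain ⟨g, C, hC, hg, hT⟩ := h
    have hg' := (hac ξ).ae_le hg
    have hm : AEStronglyMeasurable f (spectralMeasure v ξ) :=
      aestronglyMeasurable_of_tendsto_ae atTop
        (fun k => (g k).continuous.aestronglyMeasurable) hg'
    refine Integrable.mono' (integrable_const (C ^ 2)) (hm.norm.pow 2) ?_
    filter_upwards [hg'] with z hz
    rw [Real.norm_of_nonneg (by positivity)]
    exact pow_le_pow_left₀ (norm_nonneg _) (le_of_tendsto hz.norm (Eventually.of_forall fun k =>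
      ((g k).norm_coe_le_norm z).trans (hC k))) 2
  rw [hξ, norm_zero, zero_pow two_ne_zero, eq_comm, integral_eq_zero_iff_of_nonneg
    (fun z => by positivity) hint] at h1
  have hfalse : ∀ᵐ z ∂(spectralMeasure v ξ), False := by
    filter_upwards [h1, hae] with z hz hz'
    exact hz' (norm_eq_zero.1 (pow_eq_zero_iff two_ne_zero |>.1 hz))
  have huniv : spectralMeasure v ξ = 0 := by
    rw [← ae_eq_bot]; exact Filter.eventually_false_iff_eq_bot.1 hfalse
  have := norm_circleCalc_apply_sq v ξ 1
  rw [huniv, integral_zero_measure, map_one] at this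
  simpa using this

end AbsolutelyContinuous

end IsLinftyCalc

/-- An essentially bounded function is an almost everywhere limit of a uniformly bounded sequence of
continuous functions. -/
theorem exists_continuous_seq_tendsto_ae (hf : MemLp f ∞ circleMeasure) :
    ∃ (g : ℕ → C(Circle, ℂ)) (C : ℝ), (∀ k, ‖g k‖ ≤ C) ∧
      ∀ᵐ z ∂circleMeasure, Tendsto (fun k => g k z) atTop (𝓝 (f z)) := by
  have hf1 : MemLp f 1 circleMeasure := hf.mono_exponent le_top
  have happ : ∀ k : ℕ, ∃ g : C(Circle, ℂ),
      eLpNorm (f - (g : Circle → ℂ)) 1 circleMeasure ≤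
        ENNReal.ofReal (1 / ((k : ℝ) + 1)) := fun k => by
    obtain ⟨g, hg, hgm⟩ := hf1.exists_boundedContinuous_eLpNorm_sub_le ENNReal.one_ne_top
      (ε := ENNReal.ofReal (1 / ((k : ℝ) + 1))) (by
        have : (0 : ℝ) < 1 / ((k : ℝ) + 1) := Nat.one_div_pos_of_nat
        simpa using this)
    exact ⟨g.toContinuousMap, hg⟩
  choose g hg using happ
  have hlim : Tendsto (fun k => eLpNorm ((g k : Circle → ℂ) - f) 1 circleMeasure) atTop (𝓝 0) := by
    refine tendsto_of_tendsto_of_tendsto_of_le_of_le tendsto_const_nhds ?_ (fun _ => zero_le)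
      (fun k => ((eLpNorm_sub_comm _ _ _ _).trans_le (hg k)))
    rw [← ENNReal.ofReal_zero]
    exact (ENNReal.continuous_ofReal.tendsto _).comp tendsto_one_div_add_atTop_nhds_zero_nat
  obtain ⟨ns, -, hns⟩ := (tendstoInMeasure_of_tendsto_eLpNorm one_ne_zero
    (fun k => (g k).continuous.aestronglyMeasurable) hf1.aestronglyMeasurable
    hlim).exists_seq_tendsto_ae
  -- truncate at a bound for `f`
  let C : ℝ := lpNorm f ∞ circleMeasure + 1
  have hC0 : 0 < C := add_pos_of_nonneg_of_pos lpNorm_nonneg one_pos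
  have hC : ∀ᵐ z ∂circleMeasure, ‖f z‖ ≤ C := by
    filter_upwards [ae_le_lpNorm_exponent_top hf] with z hz
    exact hz.trans (le_add_of_nonneg_right zero_le_one)
  have hmax : ∀ z : ℂ, 0 < max C ‖z‖ := fun z => lt_max_of_lt_left hC0
  let r : C(ℂ, ℂ) := ⟨fun z => ((C / max C ‖z‖ : ℝ) : ℂ) * z, by
    have : Continuous fun z : ℂ => C / max C ‖z‖ :=
      continuous_const.div (continuous_const.max continuous_norm) fun z => (hmax z).ne'
    fun_prop⟩
  refine ⟨fun k => r.comp (g (ns k)), C, fun k => ?_, ?_⟩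
  · refine (ContinuousMap.norm_le _ hC0.le).2 fun z => ?_
    change ‖((C / max C ‖g (ns k) z‖ : ℝ) : ℂ) * g (ns k) z‖ ≤ C
    rw [norm_mul, Complex.norm_real, Real.norm_of_nonneg (div_nonneg hC0.le (hmax _).le),
      div_mul_eq_mul_div, div_le_iff₀ (hmax _)]
    exact mul_le_mul_of_nonneg_left (le_max_right _ _) hC0.le
  · filter_upwards [hns, hC] with z hz hzC
    have hr : r (f z) = f z := by
      change ((C / max C ‖f z‖ : ℝ) : ℂ) * f z = f z
      rw [max_eq_left hzC, div_self hC0.ne']; simp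
    have := (r.continuous.tendsto (f z)).comp hz
    rw [hr] at this
    exact this

/-- Every essentially bounded function can be applied to `v`. -/
theorem exists_isLinftyCalc (hac : ∀ ξ, spectralMeasure v ξ ≪ circleMeasure)
    (hf : MemLp f ∞ circleMeasure) : ∃ T, IsLinftyCalc v f T := by
  obtain ⟨g, C, hC, hg⟩ := exists_continuous_seq_tendsto_ae hf
  obtain ⟨T, hT⟩ := exists_strong_limit v hC fun ξ => (hac ξ).ae_le hg
  exact ⟨T, g, C, hC, hg, hT⟩

end LinftyCalculus

/-! ### Fourier coefficients and ergodic averages on the circle -/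

/-- The `n`-th Fourier coefficient of a function on the circle. -/
noncomputable def circleCoeff (f : Circle → ℂ) (n : ℤ) : ℂ :=
  ∫ z : Circle, f z * (starRingEnd ℂ) (circleMonomial n z) ∂circleMeasure

theorem circleMonomial_mul_left (n : ℤ) (c z : Circle) :
    circleMonomial n (c * z) = circleMonomial n c * circleMonomial n z := by
  simp [mul_zpow]

theorem conj_circleMonomial_mul_self (n : ℤ) (c : Circle) :
    (starRingEnd ℂ) (circleMonomial n c) * circleMonomial n c = 1 := by
  rw [circleMonomial_apply, ← Circle.coe_inv_eq_conj, ← Circle.coe_mul, inv_mul_cancel,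
    Circle.coe_one]

theorem circleCoeff_rotate (f : Circle → ℂ) (c : Circle) (n : ℤ) :
    circleCoeff (fun z => f (c * z)) n = circleMonomial n c * circleCoeff f n := by
  have h := (measurePreserving_circle_mul c).integral_comp
    (Homeomorph.mulLeft c).measurableEmbedding
    (fun z => f z * (starRingEnd ℂ) (circleMonomial n z))
  rw [circleCoeff, circleCoeff, ← h, ← integral_const_mul]
  refine integral_congr_ae (Eventually.of_forall fun z => ?_)
  have := conj_circleMonomial_mul_self n c
  simp only [circleMonomial_mul_left, map_mul]
  linear_combination (- f (c * z) * (starRingEnd ℂ) (circleMonomial n z)) * this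

theorem circleCoeff_congr {f g : Circle → ℂ} (h : f =ᵐ[circleMeasure] g) (n : ℤ) :
    circleCoeff f n = circleCoeff g n :=
  integral_congr_ae (h.mono fun z hz => by simp only [hz])

theorem circleCoeff_monomial (m n : ℤ) :
    circleCoeff (circleMonomial m) n = if m = n then 1 else 0 := by
  have h : ∀ z, circleMonomial m z * (starRingEnd ℂ) (circleMonomial n z) =
      ((z ^ (m - n) : Circle) : ℂ) := fun z => by
    rw [circleMonomial_apply, circleMonomial_apply, ← Circle.coe_inv_eq_conj, ← Circle.coe_mul,
      zpow_sub]
  simp only [circleCoeff, h]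
  split_ifs with hmn
  · simp [hmn]
  · exact integral_circleMonomial (sub_ne_zero.2 hmn)

/-- The monomial `zⁿ` as a vector of `L²(S¹)`. -/
noncomputable def circleMonomialL2 (n : ℤ) : Lp ℂ 2 circleMeasure :=
  ContinuousMap.toLp 2 circleMeasure ℂ (circleMonomial n)

theorem coeFn_circleMonomialL2 (n : ℤ) :
    circleMonomialL2 n =ᵐ[circleMeasure] circleMonomial n :=
  ContinuousMap.coeFn_toLp _ _

theorem inner_circleMonomialL2 (x : Lp ℂ 2 circleMeasure) (n : ℤ) :
    ⟪circleMonomialL2 n, x⟫_ℂ = circleCoeff x n := by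
  rw [L2.inner_def]
  refine integral_congr_ae ?_
  filter_upwards [coeFn_circleMonomialL2 n] with z hz
  rw [hz]; rfl

theorem eq_zero_of_circleCoeff_L2 {x : Lp ℂ 2 circleMeasure} (h : ∀ n, circleCoeff x n = 0) :
    x = 0 := by
  let F : C(Circle, ℂ) →L[ℂ] ℂ := (innerSL ℂ x).comp (ContinuousMap.toLp 2 circleMeasure ℂ)
  have hF : F = 0 := eq_of_forall_circleMonomial fun n => by
    change ⟪x, circleMonomialL2 n⟫_ℂ = 0
    rw [← inner_conj_symm, inner_circleMonomialL2, h, map_zero]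
  have hd := ContinuousMap.toLp_denseRange (p := 2) ℂ circleMeasure ℂ (by norm_num)
  refine hd.eq_zero_of_inner_right ℂ ?_
  intro g
  rw [← inner_conj_symm]
  have : F g = 0 := by rw [hF]; rfl
  exact (congrArg _ this).trans (map_zero _)

/-- An `L²` function is determined by its Fourier coefficients. -/
theorem ae_eq_of_circleCoeff_eq {f g : Circle → ℂ} (hf : MemLp f 2 circleMeasure)
    (hg : MemLp g 2 circleMeasure) (h : ∀ n, circleCoeff f n = circleCoeff g n) :
    f =ᵐ[circleMeasure] g := by
  have : hf.toLp f - hg.toLp g = 0 := eq_zero_of_circleCoeff_L2 fun n => by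
    rw [← inner_circleMonomialL2, inner_sub_right, inner_circleMonomialL2, inner_circleMonomialL2,
      circleCoeff_congr hf.coeFn_toLp, circleCoeff_congr hg.coeFn_toLp, h, sub_self]
  exact (MemLp.toLp_eq_toLp_iff hf hg).1 (sub_eq_zero.1 this)

/-- The twisted ergodic averages of an `L²` function under an irrational rotation extract one term
of its Fourier series. -/
theorem exists_ergodic_average_tendsto_ae {f : Circle → ℂ} (hf : MemLp f 2 circleMeasure)
    {c : Circle} (hc : ∀ n : ℤ, n ≠ 0 → c ^ n ≠ 1) (j : ℤ) :
    ∃ ns : ℕ → ℕ, ∀ᵐ z ∂circleMeasure, Tendsto (fun i => (ns i : ℂ)⁻¹ *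
      ∑ k ∈ Finset.range (ns i), circleMonomial (-j) (c ^ k) * f (c ^ k * z)) atTop
      (𝓝 (circleCoeff f j * circleMonomial j z)) := by
  -- the isometry `(A x)(z) = c⁻ʲ x(c z)` multiplies the `n`-th Fourier coefficient by `cⁿ⁻ʲ`, so it
  -- fixes exactly the multiples of `zʲ`
  let L : Lp ℂ 2 circleMeasure →ₗᵢ[ℂ] Lp ℂ 2 circleMeasure :=
    Lp.compMeasurePreservingₗᵢ ℂ _ (measurePreserving_circle_mul c)
  let A : Lp ℂ 2 circleMeasure →L[ℂ] Lp ℂ 2 circleMeasure :=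
    circleMonomial (-j) c • L.toContinuousLinearMap
  have hA1 : ‖A‖ ≤ 1 := by
    refine ContinuousLinearMap.opNorm_le_bound _ zero_le_one fun x => ?_
    change ‖circleMonomial (-j) c • L x‖ ≤ _
    rw [norm_smul, L.norm_map, circleMonomial_apply, Circle.norm_coe]
  have hAcoe : ∀ x : Lp ℂ 2 circleMeasure,
      A x =ᵐ[circleMeasure] fun z => circleMonomial (-j) c * x (c * z) := by
    intro x
    filter_upwards [Lp.coeFn_smul (circleMonomial (-j) c) (L x),
      Lp.coeFn_compMeasurePreserving x (measurePreserving_circle_mul c)] with z h1 h2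
    refine h1.trans ?_
    rw [Pi.smul_apply, smul_eq_mul]
    exact congrArg _ h2
  have hAcoeff : ∀ (x : Lp ℂ 2 circleMeasure) n,
      circleCoeff (A x) n = circleMonomial (n - j) c * circleCoeff x n := by
    intro x n
    rw [circleCoeff_congr (hAcoe x), sub_eq_add_neg, circleMonomial_add,
      mul_comm (circleMonomial n), ContinuousMap.mul_apply, mul_assoc, ← circleCoeff_rotate]
    simp only [circleCoeff, mul_assoc, integral_const_mul]
  let G := hf.toLp f
  have hiter : ∀ k : ℕ, (A^[k] G : Lp ℂ 2 circleMeasure) =ᵐ[circleMeasure]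
      fun z => circleMonomial (-j) (c ^ k) * f (c ^ k * z) := by
    intro k
    induction k with
    | zero => simpa using hf.coeFn_toLp
    | succ k ih =>
      rw [Function.iterate_succ_apply']
      filter_upwards [hAcoe (A^[k] G),
        (measurePreserving_circle_mul c).quasiMeasurePreserving.ae ih] with z h1 h2
      rw [h1, h2, pow_succ', circleMonomial_mul_left, mul_assoc, mul_right_comm c,
        mul_comm (c * z)]
  have hlim := A.tendsto_birkhoffAverage_orthogonalProjection hA1 G
  let S := A.eqLocus (1 : Lp ℂ 2 circleMeasure →L[ℂ] Lp ℂ 2 circleMeasure)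
  let Q : Lp ℂ 2 circleMeasure := S.orthogonalProjectionOnto G
  have hQfix : A Q = Q := (S.orthogonalProjectionOnto G).2
  have hQcoeff : ∀ n, circleCoeff Q n = if n = j then circleCoeff f j else 0 := by
    intro n
    split_ifs with hn
    · subst hn
      have hmem : circleMonomialL2 n ∈ S := by
        change A (circleMonomialL2 n) = circleMonomialL2 n
        refine sub_eq_zero.1 (eq_zero_of_circleCoeff_L2 fun m => ?_)
        rw [← inner_circleMonomialL2, inner_sub_right, inner_circleMonomialL2,
          inner_circleMonomialL2, hAcoeff, circleCoeff_congr (coeFn_circleMonomialL2 n),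
          circleCoeff_monomial]
        split_ifs with h
        · subst h; simp
        · simp
      have h1 : ⟪circleMonomialL2 n, G - Q⟫_ℂ = 0 :=
        S.sub_starProjection_mem_orthogonal G _ hmem
      rw [inner_sub_right, sub_eq_zero] at h1
      rw [← inner_circleMonomialL2, ← h1, inner_circleMonomialL2,
        circleCoeff_congr hf.coeFn_toLp]
    · have h1 := hAcoeff Q n
      rw [hQfix] at h1
      have h2 : circleMonomial (n - j) c ≠ 1 := fun h => hc (n - j) (sub_ne_zero.2 hn)
        (Circle.ext (by simpa using h))
      have h3 : (circleMonomial (n - j) c - 1) * circleCoeff Q n = 0 := by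
        linear_combination -h1
      exact (mul_eq_zero.1 h3).resolve_left (sub_ne_zero.2 h2)
  have hQ : Q = circleCoeff f j • circleMonomialL2 j := by
    refine sub_eq_zero.1 (eq_zero_of_circleCoeff_L2 fun m => ?_)
    rw [← inner_circleMonomialL2, inner_sub_right, inner_smul_right, inner_circleMonomialL2,
      inner_circleMonomialL2, hQcoeff, circleCoeff_congr (coeFn_circleMonomialL2 j),
      circleCoeff_monomial]
    by_cases h : m = j
    · simp [h]
    · simp [h, Ne.symm h]
  -- convergence in `L²` yields a subsequence converging almost everywhere
  obtain ⟨ns, -, hns⟩ := (tendstoInMeasure_of_tendsto_Lp hlim).exists_seq_tendsto_ae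
  have hQcoe : Q =ᵐ[circleMeasure] fun z => circleCoeff f j * circleMonomial j z := by
    rw [hQ]
    filter_upwards [Lp.coeFn_smul (circleCoeff f j) (circleMonomialL2 j),
      coeFn_circleMonomialL2 j] with z h1 h2
    rw [h1, Pi.smul_apply, h2, smul_eq_mul]
  have havg : ∀ K : ℕ, (birkhoffAverage ℂ A _root_.id K G : Lp ℂ 2 circleMeasure)
      =ᵐ[circleMeasure] fun z => (K : ℂ)⁻¹ *
        ∑ k ∈ Finset.range K, circleMonomial (-j) (c ^ k) * f (c ^ k * z) := by
    intro K
    have hsum : ∀ K : ℕ, (∑ k ∈ Finset.range K, A^[k] G : Lp ℂ 2 circleMeasure) =ᵐ[circleMeasure]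
        fun z => ∑ k ∈ Finset.range K, circleMonomial (-j) (c ^ k) * f (c ^ k * z) := by
      intro K
      induction K with
      | zero =>
        simp only [Finset.range_zero, Finset.sum_empty]
        exact Lp.coeFn_zero ℂ 2 circleMeasure
      | succ K ih =>
        rw [Finset.sum_range_succ]
        filter_upwards [Lp.coeFn_add (∑ k ∈ Finset.range K, A^[k] G) (A^[K] G), ih, hiter K]
          with z h1 h2 h3
        rw [h1, Pi.add_apply, h2, h3, Finset.sum_range_succ]
    filter_upwards [Lp.coeFn_smul (K : ℂ)⁻¹ (∑ k ∈ Finset.range K, A^[k] G), hsum K] with z h1 h2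
    refine Eq.trans h1 ?_
    rw [Pi.smul_apply, h2, smul_eq_mul]
  refine ⟨ns, ?_⟩
  filter_upwards [hns, hQcoe, ae_all_iff.2 fun i => havg (ns i)] with z h1 h2 h3
  rw [← h2]
  exact h1.congr h3

/-- An `L²` function whose Fourier coefficients are supported on `nℤ` is invariant under rotation by
`n`-th roots of unity. -/
theorem ae_eq_rotate_of_circleCoeff {f : Circle → ℂ} (hf : MemLp f 2 circleMeasure) {n : ℕ}
    (hn : ∀ j : ℤ, ¬ (n : ℤ) ∣ j → circleCoeff f j = 0) {c : Circle} (hc : c ^ n = 1) :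
    (fun z => f (c * z)) =ᵐ[circleMeasure] f := by
  refine ae_eq_of_circleCoeff_eq (hf.comp_measurePreserving (measurePreserving_circle_mul c)) hf
    fun j => ?_
  rw [circleCoeff_rotate]
  by_cases hj : (n : ℤ) ∣ j
  · obtain ⟨k, rfl⟩ := hj
    rw [circleMonomial_apply, zpow_mul, zpow_natCast, hc]; simp
  · rw [hn j hj, mul_zero]

/-! ### Pairs of unitaries generating an irrational rotation algebra -/

section RotationPair

variable {H : Type w} [NormedAddCommGroup H] [InnerProductSpace ℂ H] [CompleteSpace H]

/-- Two unitaries with `V U = c U V`, where `c` is not a root of unity. -/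
structure IsRotationPair (U V : unitary (H →L[ℂ] H)) (c : Circle) : Prop where
  comm : V * U = scalarUnitary H c * (U * V)
  irrational : ∀ n : ℤ, n ≠ 0 → c ^ n ≠ 1

/-- The monomial `Uᵃ Vᵇ`. -/
noncomputable def rotationWord (U V : unitary (H →L[ℂ] H)) (p : ℤ × ℤ) : unitary (H →L[ℂ] H) :=
  U ^ p.1 * V ^ p.2

theorem coe_eq_smul_of_eq_scalarUnitary_mul {x y : unitary (H →L[ℂ] H)} {d : Circle}
    (h : x = scalarUnitary H d * y) : (x : H →L[ℂ] H) = (d : ℂ) • (y : H →L[ℂ] H) := by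
  rw [h, Submonoid.coe_mul, coe_scalarUnitary, smul_mul_assoc, one_mul]

theorem rotationWord_zero (U V : unitary (H →L[ℂ] H)) : rotationWord U V 0 = 1 := by
  simp [rotationWord]

namespace IsRotationPair

variable {U V : unitary (H →L[ℂ] H)} {c : Circle}

theorem zpow_comm (h : IsRotationPair U V c) (a b : ℤ) :
    V ^ b * U ^ a = scalarUnitary H (c ^ (a * b)) * (U ^ a * V ^ b) := by
  have h1 : SemiconjBy V U (scalarUnitary H c * U) := by
    change V * U = scalarUnitary H c * U * V
    rw [h.comm, mul_assoc]
  have h2 := (h1.zpow_right a).eq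
  rw [(scalarUnitary_comm c U).mul_zpow, ← map_zpow, mul_assoc] at h2
  have h3 : SemiconjBy (U ^ a) (scalarUnitary H (c ^ a) * V) V := by
    change U ^ a * (scalarUnitary H (c ^ a) * V) = V * U ^ a
    rw [h2, ← mul_assoc, ← mul_assoc, (scalarUnitary_comm (c ^ a) (U ^ a)).eq]
  have h4 := (h3.zpow_right b).eq
  rw [(scalarUnitary_comm (c ^ a) V).mul_zpow, ← map_zpow, ← mul_assoc,
    ← (scalarUnitary_comm _ (U ^ a)).eq, ← zpow_mul, mul_assoc] at h4
  exact h4.symm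

theorem pow (h : IsRotationPair U V c) {n : ℕ} (hn : n ≠ 0) :
    IsRotationPair U (V ^ n) (c ^ n) where
  comm := by
    have := h.zpow_comm 1 n
    simpa using this
  irrational k hk := by
    rw [← zpow_natCast, ← zpow_mul]
    exact h.irrational _ (mul_ne_zero (by exact_mod_cast hn) hk)

theorem exists_word_mul (h : IsRotationPair U V c) (p q : ℤ × ℤ) :
    ∃ d : Circle, rotationWord U V p * rotationWord U V q =
      scalarUnitary H d * rotationWord U V (p + q) := by
  refine ⟨c ^ (q.1 * p.2), ?_⟩
  simp only [rotationWord, Prod.fst_add, Prod.snd_add, zpow_add]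
  calc U ^ p.1 * V ^ p.2 * (U ^ q.1 * V ^ q.2) = U ^ p.1 * (V ^ p.2 * U ^ q.1) * V ^ q.2 := by
        simp only [mul_assoc]
    _ = _ := by
        rw [h.zpow_comm, ← mul_assoc (U ^ p.1), ← (scalarUnitary_comm _ (U ^ p.1)).eq]
        simp only [mul_assoc]

theorem exists_word_inv (h : IsRotationPair U V c) (p : ℤ × ℤ) :
    ∃ d : Circle, (rotationWord U V p)⁻¹ = scalarUnitary H d * rotationWord U V (-p) := by
  obtain ⟨d, hd⟩ := h.exists_word_mul (-p) p
  rw [neg_add_cancel, rotationWord_zero, mul_one] at hd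
  refine ⟨d⁻¹, ?_⟩
  rw [eq_mul_inv_of_mul_eq hd, ← mul_assoc, ← map_mul, inv_mul_cancel, map_one, one_mul]

theorem word_comm_U (h : IsRotationPair U V c) (p : ℤ × ℤ) :
    U * rotationWord U V p = scalarUnitary H (c ^ (-p.2)) * (rotationWord U V p * U) := by
  have := h.zpow_comm 1 p.2
  simp only [zpow_one, one_mul] at this
  rw [rotationWord, mul_assoc (U ^ p.1), this, ← mul_assoc (U ^ p.1),
    ← (scalarUnitary_comm _ (U ^ p.1)).eq, mul_assoc (scalarUnitary H (c ^ p.2)),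
    ← mul_assoc (scalarUnitary H (c ^ (-p.2))), ← map_mul, ← zpow_add,
    neg_add_cancel, zpow_zero, map_one, one_mul, ← mul_assoc, ← mul_assoc, ← zpow_one_add,
    ← zpow_add_one, add_comm]

theorem word_comm_V (h : IsRotationPair U V c) (p : ℤ × ℤ) :
    V * rotationWord U V p = scalarUnitary H (c ^ p.1) * (rotationWord U V p * V) := by
  have := h.zpow_comm p.1 1
  simp only [zpow_one, mul_one] at this
  rw [rotationWord, ← mul_assoc, this]
  simp only [mul_assoc, ← zpow_one_add, ← zpow_add_one, add_comm]

theorem mem_span_word (U V : unitary (H →L[ℂ] H)) (d : Circle) (p : ℤ × ℤ) :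
    ((scalarUnitary H d * rotationWord U V p : unitary (H →L[ℂ] H)) : H →L[ℂ] H) ∈
      Submodule.span ℂ (Set.range fun p => (rotationWord U V p : H →L[ℂ] H)) := by
  rw [Submonoid.coe_mul, coe_scalarUnitary, smul_mul_assoc, one_mul]
  exact Submodule.smul_mem _ _ (Submodule.subset_span ⟨p, rfl⟩)

/-- The linear span of the monomials `Uᵃ Vᵇ`, a unital `⋆`-algebra. -/
noncomputable def wordAlgebra (h : IsRotationPair U V c) : StarSubalgebra ℂ (H →L[ℂ] H) where
  carrier := Submodule.span ℂ (Set.range fun p => (rotationWord U V p : H →L[ℂ] H))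
  mul_mem' := by
    intro a b ha hb
    have := Submodule.mul_mem_mul ha hb
    rw [Submodule.span_mul_span] at this
    refine Submodule.span_le.2 ?_ this
    rintro _ ⟨_, ⟨p, rfl⟩, _, ⟨q, rfl⟩, rfl⟩
    obtain ⟨d, hd⟩ := h.exists_word_mul p q
    change (rotationWord U V p : H →L[ℂ] H) * (rotationWord U V q : H →L[ℂ] H) ∈ Submodule.span _ _
    rw [← Submonoid.coe_mul, hd]
    exact mem_span_word U V d _
  add_mem' := Submodule.add_mem _
  algebraMap_mem' r := by
    rw [Algebra.algebraMap_eq_smul_one]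
    exact Submodule.smul_mem _ _ (Submodule.subset_span ⟨0, by
      simp [rotationWord_zero]⟩)
  star_mem' := by
    intro a ha
    refine Submodule.span_induction (p := fun a _ => star a ∈ Submodule.span ℂ
      (Set.range fun p => (rotationWord U V p : H →L[ℂ] H))) ?_ ?_ ?_ ?_ ha
    · rintro _ ⟨p, rfl⟩
      obtain ⟨d, hd⟩ := h.exists_word_inv p
      rw [← Unitary.coe_star, Unitary.star_eq_inv, hd]
      exact mem_span_word U V d _
    · rw [star_zero]; exact Submodule.zero_mem _
    · intro x y _ _ hx hy
      rw [star_add]; exact Submodule.add_mem _ hx hy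
    · intro r x _ hx
      rw [star_smul]; exact Submodule.smul_mem _ _ hx

end IsRotationPair

end RotationPair

namespace VonNeumannAlgebra

variable {H : Type w} [NormedAddCommGroup H] [InnerProductSpace ℂ H] [CompleteSpace H]

theorem zpow_mem {M : VonNeumannAlgebra H} {U : unitary (H →L[ℂ] H)} (hU : (U : H →L[ℂ] H) ∈ M)
    (n : ℤ) : ((U ^ n : unitary (H →L[ℂ] H)) : H →L[ℂ] H) ∈ M := by
  rw [← circleCalc_monomial]
  exact circleCalc_mem M hU _

theorem subset_generatedBy (S : Set (H →L[ℂ] H)) : S ⊆ generatedBy S := by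
  rw [coe_generatedBy]
  exact Set.subset_union_left.trans Set.subset_centralizer_centralizer

theorem generatedBy_le {S : Set (H →L[ℂ] H)} {M : VonNeumannAlgebra H} (h : S ⊆ M) :
    generatedBy S ≤ M := by
  rw [← SetLike.coe_subset_coe, coe_generatedBy, ← M.centralizer_centralizer]
  refine Set.centralizer_subset (Set.centralizer_subset (Set.union_subset h ?_))
  intro x hx
  have := star_mem (h hx)
  rwa [star_star] at this

section Basis

variable {U V : unitary (H →L[ℂ] H)} {c : Circle} {M : VonNeumannAlgebra H} {τ : M →ₚ[ℂ] ℂ}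

theorem rotationWord_mem (hU : (U : H →L[ℂ] H) ∈ M) (hV : (V : H →L[ℂ] H) ∈ M) (p : ℤ × ℤ) :
    (rotationWord U V p : H →L[ℂ] H) ∈ M :=
  mul_mem (zpow_mem hU _) (zpow_mem hV _)

/-- The monomial `Uᵃ Vᵇ` as an element of `M`. -/
noncomputable def wordIn (hU : (U : H →L[ℂ] H) ∈ M) (hV : (V : H →L[ℂ] H) ∈ M) (p : ℤ × ℤ) : M :=
  ⟨rotationWord U V p, rotationWord_mem hU hV p⟩

/-- An element that a unitary of `M` commutes with up to a scalar `d ≠ 1` has trace zero. -/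
theorem IsTrace.eq_zero_of_smul_comm (hτ : IsTrace τ) {x y : M} (hy : y * star y = 1)
    (hy' : star y * y = 1) {d : ℂ} (hd : d ≠ 1) (h : y * x = d • (x * y)) : τ x = 0 := by
  have h1 : τ x = d * τ x := by
    calc τ x = τ (star y * (y * x)) := by rw [← mul_assoc, hy', one_mul]
      _ = d * τ x := by
        rw [h, mul_smul_comm, map_smul, hτ.tracial, mul_assoc, hy, mul_one, smul_eq_mul]
  have h2 : (1 - d) * τ x = 0 := by linear_combination h1
  exact (mul_eq_zero.1 h2).resolve_left (sub_ne_zero.2 hd.symm)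

/-- An element commuting with a unitary `y` is orthogonal in `L²(M, τ)` to every element that
commutes with `y` up to a scalar `d ≠ 1`. -/
theorem IsTrace.inner_eq_zero_of_smul_comm (hτ : IsTrace τ) {x y w : M} (hy : y * star y = 1)
    (hy' : star y * y = 1) {d : ℂ} (hd : d ≠ 1) (hw : y * w = d • (w * y)) (hx : y * x = x * y) :
    ⟪gnsHat τ w, gnsHat τ x⟫_ℂ = 0 := by
  rw [inner_gnsHat]
  have h1 : star w * star y = star d • (star y * star w) := by
    rw [← star_mul, hw, star_smul, star_mul]
  have h2 : y * star w = star d • (star w * y) := by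
    calc y * star w = y * (star w * star y) * y := by
          rw [mul_assoc, mul_assoc (star w), hy', mul_one]
      _ = _ := by rw [h1, mul_smul_comm, ← mul_assoc, hy, one_mul, smul_mul_assoc]
  refine hτ.eq_zero_of_smul_comm hy hy' (d := star d) (fun h => hd ?_) ?_
  · rw [← star_star d, h, star_one]
  · rw [← mul_assoc, h2, smul_mul_assoc, mul_assoc, hx, mul_assoc]

theorem coe_mul_star_self (U : unitary (H →L[ℂ] H)) (hU : (U : H →L[ℂ] H) ∈ M) :
    (⟨U, hU⟩ : M) * star (⟨U, hU⟩ : M) = 1 := Subtype.ext (Unitary.coe_mul_star_self U)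

theorem coe_star_mul_self (U : unitary (H →L[ℂ] H)) (hU : (U : H →L[ℂ] H) ∈ M) :
    star (⟨U, hU⟩ : M) * (⟨U, hU⟩ : M) = 1 := Subtype.ext (Unitary.coe_star_mul_self U)

variable (h : IsRotationPair U V c) (hU : (U : H →L[ℂ] H) ∈ M) (hV : (V : H →L[ℂ] H) ∈ M)

include h

theorem U_mul_wordIn (p : ℤ × ℤ) : (⟨U, hU⟩ : M) * wordIn hU hV p =
    ((c ^ (-p.2) : Circle) : ℂ) • (wordIn hU hV p * (⟨U, hU⟩ : M)) := by
  exact Subtype.ext (coe_eq_smul_of_eq_scalarUnitary_mul (h.word_comm_U p))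

theorem V_mul_wordIn (p : ℤ × ℤ) : (⟨V, hV⟩ : M) * wordIn hU hV p =
    ((c ^ p.1 : Circle) : ℂ) • (wordIn hU hV p * (⟨V, hV⟩ : M)) := by
  exact Subtype.ext (coe_eq_smul_of_eq_scalarUnitary_mul (h.word_comm_V p))

theorem star_wordIn_mul (p q : ℤ × ℤ) : ∃ d : Circle,
    star (wordIn hU hV p) * wordIn hU hV q = (d : ℂ) • wordIn hU hV (q - p) := by
  obtain ⟨d, hd⟩ := h.exists_word_inv p
  obtain ⟨e, he⟩ := h.exists_word_mul (-p) q
  refine ⟨d * e, Subtype.ext ?_⟩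
  have h1 : (rotationWord U V p)⁻¹ * rotationWord U V q =
      scalarUnitary H (d * e) * rotationWord U V (q - p) := by
    rw [hd, mul_assoc, he, ← mul_assoc, ← map_mul, neg_add_eq_sub]
  exact coe_eq_smul_of_eq_scalarUnitary_mul h1

theorem star_wordIn (p : ℤ × ℤ) : ∃ d : Circle,
    star (wordIn hU hV p) = (d : ℂ) • wordIn hU hV (-p) := by
  obtain ⟨d, hd⟩ := star_wordIn_mul h hU hV p 0
  have h0 : wordIn hU hV 0 = 1 := Subtype.ext
    (congrArg (fun x : unitary (H →L[ℂ] H) => (x : H →L[ℂ] H)) (rotationWord_zero U V))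
  rw [h0, mul_one, zero_sub] at hd
  exact ⟨d, hd⟩

theorem IsRotationPair.coe_zpow_ne_one {n : ℤ} (hn : n ≠ 0) : ((c ^ n : Circle) : ℂ) ≠ 1 :=
  fun h1 => h.irrational n hn (Circle.ext (by simpa using h1))

/-- A nontrivial monomial commutes with `U` or with `V` up to a scalar different from `1`. -/
theorem IsTrace.wordIn_eq_zero (hτ : IsTrace τ) {p : ℤ × ℤ} (hp : p ≠ 0) :
    τ (wordIn hU hV p) = 0 := by
  by_cases h1 : p.1 = 0
  · have h2 : p.2 ≠ 0 := fun h2 => hp (Prod.ext h1 h2)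
    exact hτ.eq_zero_of_smul_comm (coe_mul_star_self U hU) (coe_star_mul_self U hU)
      (IsRotationPair.coe_zpow_ne_one h (neg_ne_zero.2 h2)) (U_mul_wordIn h hU hV p)
  · exact hτ.eq_zero_of_smul_comm (coe_mul_star_self V hV) (coe_star_mul_self V hV)
      (IsRotationPair.coe_zpow_ne_one h h1) (V_mul_wordIn h hU hV p)

theorem IsTrace.orthonormal_word (hτ : IsTrace τ) :
    Orthonormal ℂ fun p => gnsHat τ (wordIn hU hV p) := by
  rw [orthonormal_iff_ite]
  intro p q
  rw [inner_gnsHat]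
  split_ifs with hpq
  · subst hpq
    rw [show star (wordIn hU hV p) * wordIn hU hV p = 1 from coe_star_mul_self _ _, hτ.map_one]
  · obtain ⟨d, hd⟩ := star_wordIn_mul h hU hV p q
    rw [hd, map_smul, hτ.wordIn_eq_zero h hU hV (sub_ne_zero.2 (Ne.symm hpq)), smul_zero]

omit h in
theorem mem_of_generatedBy_eq (hM : generatedBy {(U : H →L[ℂ] H), (V : H →L[ℂ] H)} = M) :
    (U : H →L[ℂ] H) ∈ M ∧ (V : H →L[ℂ] H) ∈ M := by
  have := subset_generatedBy {(U : H →L[ℂ] H), (V : H →L[ℂ] H)}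
  rw [hM] at this
  exact ⟨this (by simp), this (by simp)⟩

theorem centralizer_centralizer_wordAlgebra
    (hM : generatedBy {(U : H →L[ℂ] H), (V : H →L[ℂ] H)} = M) :
    Set.centralizer (Set.centralizer (h.wordAlgebra : Set (H →L[ℂ] H))) = M := by
  obtain ⟨hU, hV⟩ := mem_of_generatedBy_eq hM
  apply le_antisymm
  · rw [← M.centralizer_centralizer]
    refine Set.centralizer_subset (Set.centralizer_subset ?_)
    change Submodule.span ℂ _ ≤ M.toStarSubalgebra.toSubalgebra.toSubmodule
    rw [Submodule.span_le]
    rintro _ ⟨p, rfl⟩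
    exact rotationWord_mem hU hV p
  · rw [← hM, coe_generatedBy]
    have hmem : ∀ p, (rotationWord U V p : H →L[ℂ] H) ∈ h.wordAlgebra := fun p =>
      Submodule.subset_span ⟨p, rfl⟩
    have hs : {(U : H →L[ℂ] H), (V : H →L[ℂ] H)} ⊆ (h.wordAlgebra : Set (H →L[ℂ] H)) := by
      rintro x (rfl | rfl)
      · simpa [rotationWord] using hmem (1, 0)
      · simpa [rotationWord] using hmem (0, 1)
    refine Set.centralizer_subset (Set.centralizer_subset (Set.union_subset hs ?_))
    intro x hx
    have := star_mem (s := h.wordAlgebra) (hs hx)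
    rwa [star_star] at this

omit hU hV in
theorem IsTrace.dense_word (hτ : IsTrace τ)
    (hM : generatedBy {(U : H →L[ℂ] H), (V : H →L[ℂ] H)} = M)
    (hU : (U : H →L[ℂ] H) ∈ M) (hV : (V : H →L[ℂ] H) ∈ M) :
    ⊤ ≤ (Submodule.span ℂ (Set.range fun p => gnsHat τ (wordIn hU hV p))).topologicalClosure := by
  intro ψ _
  refine closure_mono ?_ (hτ.gnsHat_mem_closure h.wordAlgebra
    (centralizer_centralizer_wordAlgebra h hM) ψ)
  rintro _ ⟨⟨a, haM⟩, ha, rfl⟩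
  change a ∈ Submodule.span ℂ _ at ha
  have key : ∀ haM : a ∈ M, gnsHat τ ⟨a, haM⟩ ∈
      Submodule.span ℂ (Set.range fun p => gnsHat τ (wordIn hU hV p)) := by
    clear haM
    have hspan : ∀ a ∈ Submodule.span ℂ (Set.range fun p => (rotationWord U V p : H →L[ℂ] H)),
        a ∈ M := by
      change Submodule.span ℂ _ ≤ M.toStarSubalgebra.toSubalgebra.toSubmodule
      rw [Submodule.span_le]
      rintro _ ⟨p, rfl⟩
      exact rotationWord_mem hU hV p
    refine Submodule.span_induction (p := fun a _ => ∀ haM : a ∈ M, gnsHat τ ⟨a, haM⟩ ∈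
      Submodule.span ℂ (Set.range fun p => gnsHat τ (wordIn hU hV p))) ?_ ?_ ?_ ?_ ha
    · rintro _ ⟨p, rfl⟩ _
      exact Submodule.subset_span ⟨p, rfl⟩
    · intro h0
      rw [show (⟨0, h0⟩ : M) = 0 from rfl, map_zero]
      exact Submodule.zero_mem _
    · intro x y hx hy h1 h2 hxy
      rw [show (⟨x + y, hxy⟩ : M) = ⟨x, hspan x hx⟩ + ⟨y, hspan y hy⟩ from rfl, map_add]
      exact Submodule.add_mem _ (h1 _) (h2 _)
    · intro r x hx h1 hrx
      rw [show (⟨r • x, hrx⟩ : M) = r • ⟨x, hspan x hx⟩ from rfl, map_smul]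
      exact Submodule.smul_mem _ _ (h1 _)
  exact key haM

omit hU hV in
/-- The vectors `(Uᵃ Vᵇ)^` form a Hilbert basis of `L²(M, τ)` if `U` and `V` generate `M`. -/
noncomputable def IsTrace.wordBasis (hτ : IsTrace τ)
    (hM : generatedBy {(U : H →L[ℂ] H), (V : H →L[ℂ] H)} = M)
    (hU : (U : H →L[ℂ] H) ∈ M) (hV : (V : H →L[ℂ] H) ∈ M) : HilbertBasis (ℤ × ℤ) ℂ τ.GNS :=
  HilbertBasis.mk (hτ.orthonormal_word h hU hV) (hτ.dense_word h hM hU hV)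

theorem IsTrace.wordBasis_apply (hτ : IsTrace τ)
    (hM : generatedBy {(U : H →L[ℂ] H), (V : H →L[ℂ] H)} = M) (p : ℤ × ℤ) :
    hτ.wordBasis h hM hU hV p = gnsHat τ (wordIn hU hV p) := by
  rw [IsTrace.wordBasis, HilbertBasis.coe_mk]

/-- An element of `M = {U, V}''` commuting with `U` and with a positive power of `V` is a scalar:
its Fourier coefficients at the nontrivial monomials vanish. -/
theorem IsTrace.eq_smul_one_of_commute (hτ : IsTrace τ)
    (hM : generatedBy {(U : H →L[ℂ] H), (V : H →L[ℂ] H)} = M) {n : ℕ} (hn : n ≠ 0)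
    {x : H →L[ℂ] H} (hx : x ∈ M) (hxU : (U : H →L[ℂ] H) * x = x * (U : H →L[ℂ] H))
    (hxV : ((V ^ n : unitary (H →L[ℂ] H)) : H →L[ℂ] H) * x =
      x * ((V ^ n : unitary (H →L[ℂ] H)) : H →L[ℂ] H)) : ∃ a : ℂ, x = a • (1 : H →L[ℂ] H) := by
  obtain ⟨hU, hV⟩ := mem_of_generatedBy_eq hM
  have hVn : ((V ^ n : unitary (H →L[ℂ] H)) : H →L[ℂ] H) ∈ M := by
    simpa using pow_mem hV n
  have hzero : ∀ p : ℤ × ℤ, p ≠ 0 → ⟪gnsHat τ (wordIn hU hV p), gnsHat τ ⟨x, hx⟩⟫_ℂ = 0 := by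
    intro p hp
    by_cases h1 : p.1 = 0
    · have h2 : p.2 ≠ 0 := fun h2 => hp (Prod.ext h1 h2)
      exact hτ.inner_eq_zero_of_smul_comm (coe_mul_star_self U hU) (coe_star_mul_self U hU)
        (IsRotationPair.coe_zpow_ne_one h (neg_ne_zero.2 h2)) (U_mul_wordIn h hU hV p)
        (Subtype.ext hxU)
    · refine hτ.inner_eq_zero_of_smul_comm (coe_mul_star_self _ hVn) (coe_star_mul_self _ hVn)
        (IsRotationPair.coe_zpow_ne_one h (mul_ne_zero h1 (Int.natCast_ne_zero.2 hn)))
        (Subtype.ext ?_) (Subtype.ext hxV)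
      have h3 : V ^ n * rotationWord U V p =
          scalarUnitary H (c ^ (p.1 * n)) * (rotationWord U V p * V ^ n) := by
        have := h.zpow_comm p.1 n
        rw [rotationWord, ← zpow_natCast, ← mul_assoc, this]
        simp only [mul_assoc, ← zpow_add, add_comm]
      exact coe_eq_smul_of_eq_scalarUnitary_mul h3
  have hsum := (hτ.wordBasis h hM hU hV).hasSum_repr (gnsHat τ ⟨x, hx⟩)
  simp only [HilbertBasis.repr_apply_apply, hτ.wordBasis_apply h hU hV hM] at hsum
  have h0 := hsum.unique (hasSum_single 0 fun p hp => by rw [hzero p hp, zero_smul])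
  refine ⟨⟪gnsHat τ (wordIn hU hV 0), gnsHat τ ⟨x, hx⟩⟫_ℂ, ?_⟩
  rw [← map_smul] at h0
  have h1 := congrArg (fun y : M => (y : H →L[ℂ] H)) (hτ.gnsHat_injective h0)
  refine h1.trans ?_
  change _ • ((rotationWord U V 0 : unitary (H →L[ℂ] H)) : H →L[ℂ] H) = _
  rw [rotationWord_zero]; rfl

end Basis

end VonNeumannAlgebra

/-! ### The Jones index -/

/-- Parseval's identity as a sum of extended nonnegative reals. -/
theorem HilbertBasis.tsum_ofReal_norm_inner_sq {ι E : Type*} [NormedAddCommGroup E]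
    [InnerProductSpace ℂ E] (b : HilbertBasis ι ℂ E) (x : E) :
    ∑' i, ENNReal.ofReal (‖⟪b i, x⟫_ℂ‖ ^ 2) = ENNReal.ofReal (‖x‖ ^ 2) := by
  have h2 : (0 : ℝ) < (2 : ℝ≥0∞).toReal := by norm_num
  have h : HasSum (fun i => ‖⟪b i, x⟫_ℂ‖ ^ 2) (‖x‖ ^ 2) := by
    have := lp.hasSum_norm h2 (b.repr x)
    simpa [b.repr_apply_apply, b.repr.norm_map] using this
  rw [← h.tsum_eq, ENNReal.ofReal_tsum_of_nonneg (fun i => by positivity) h.summable]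

/-- Division with remainder by `n`, applied to the second index of a double series. -/
theorem tsum_int_prod_eq_sum_range (n : ℕ) (hn : n ≠ 0) (F : ℤ × ℤ → ℝ≥0∞) :
    ∑' q, F q = ∑ j ∈ Finset.range n, ∑' p : ℤ × ℤ, F (p.1, n * p.2 + j) := by
  have : NeZero n := ⟨hn⟩
  calc ∑' q, F q = ∑' a, ∑' l, F (a, l) := ENNReal.tsum_prod'
    _ = ∑' a, ∑' kj : ℤ × Fin n, F (a, (Int.divModEquiv n).symm kj) :=
        tsum_congr fun a => ((Int.divModEquiv n).symm.tsum_eq fun l => F (a, l)).symm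
    _ = ∑' (a : ℤ) (j : Fin n) (k : ℤ), F (a, n * k + (j : ℕ)) := tsum_congr fun a => by
        rw [ENNReal.tsum_prod', ENNReal.tsum_comm]
        simp only [Int.divModEquiv_symm_apply, mul_comm (n : ℤ)]
    _ = ∑' j : Fin n, ∑' p : ℤ × ℤ, F (p.1, n * p.2 + (j : ℕ)) := by
        rw [ENNReal.tsum_comm]
        exact tsum_congr fun j =>
          (ENNReal.tsum_prod' (f := fun p : ℤ × ℤ => F (p.1, n * p.2 + (j : ℕ)))).symm
    _ = _ := by
        rw [tsum_fintype, Finset.sum_range (fun j => ∑' p : ℤ × ℤ, F (p.1, n * p.2 + j))]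

section Parseval

variable {K L : Type*} [NormedAddCommGroup K] [InnerProductSpace ℂ K] [CompleteSpace K]
  [NormedAddCommGroup L] [InnerProductSpace ℂ L] [CompleteSpace L]

/-- Maps `E j`, `j < n`, that carry an orthonormal basis of `L` to the parts of an orthonormal basis
of `K` with second index congruent to `j` identify `K` with the sum of `n` copies of `L`. -/
theorem exists_linearIsometry_of_basis {n : ℕ} (hn : n ≠ 0) (bK : HilbertBasis (ℤ × ℤ) ℂ K)
    (bL : HilbertBasis (ℤ × ℤ) ℂ L) (E : ℕ → L →L[ℂ] K)
    (hE : ∀ (j : ℕ) (p : ℤ × ℤ), E j (bL p) = bK (p.1, n * p.2 + j)) :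
    ∃ W : K →ₗᵢ[ℂ] lp (fun _ : ℕ => L) 2,
      ∀ ξ i, W ξ i = if i ∈ Finset.range n then (E i).adjoint ξ else 0 := by
  let W₀ : K →L[ℂ] lp (fun _ : ℕ => L) 2 := ∑ j ∈ Finset.range n,
    (lp.singleContinuousLinearMap ℂ (fun _ : ℕ => L) 2 j).comp (E j).adjoint
  have hW₀ : ∀ ξ, W₀ ξ = ∑ j ∈ Finset.range n, lp.single 2 j ((E j).adjoint ξ) := fun ξ => by
    simp [W₀]
  have hiso : ∀ ξ, ‖W₀ ξ‖ = ‖ξ‖ := by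
    intro ξ
    have h3 : ‖W₀ ξ‖ ^ 2 = ∑ j ∈ Finset.range n, ‖(E j).adjoint ξ‖ ^ 2 := by
      have := lp.norm_sum_single (p := 2) (by norm_num) (fun j => (E j).adjoint ξ) (Finset.range n)
      rw [← hW₀] at this
      simpa using this
    have h4 : ENNReal.ofReal (‖W₀ ξ‖ ^ 2) = ENNReal.ofReal (‖ξ‖ ^ 2) := by
      rw [h3, ENNReal.ofReal_sum_of_nonneg fun _ _ => by positivity,
        ← bK.tsum_ofReal_norm_inner_sq, tsum_int_prod_eq_sum_range n hn]
      refine Finset.sum_congr rfl fun j _ => ?_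
      rw [← bL.tsum_ofReal_norm_inner_sq]
      refine tsum_congr fun p => ?_
      rw [ContinuousLinearMap.adjoint_inner_right, hE]
    rw [ENNReal.ofReal_eq_ofReal_iff (by positivity) (by positivity)] at h4
    exact (pow_left_inj₀ (norm_nonneg _) (norm_nonneg _) two_ne_zero).1 h4
  refine ⟨⟨W₀.toLinearMap, hiso⟩, fun ξ i => ?_⟩
  change W₀ ξ i = _
  rw [hW₀, lp.coeFn_sum, Finset.sum_apply]
  simp only [lp.coeFn_single, Finset.sum_pi_single]

omit [CompleteSpace K] [CompleteSpace L] in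
/-- Parseval's identity in `K` and in `L`, for vectors `e i` of `K` whose coefficients are, up to
phases, those of the components of an isometry `W` of `K` into a sum of copies of `L`. -/
theorem tsum_norm_sq_of_basis {n : ℕ} (hn : n ≠ 0) (bK : HilbertBasis (ℤ × ℤ) ℂ K)
    (bL : HilbertBasis (ℤ × ℤ) ℂ L) (W : K →ₗᵢ[ℂ] lp (fun _ : ℕ => L) 2) (e : ℕ → K)
    (he : ∀ (i j : ℕ) (p : ℤ × ℤ),
      ‖⟪bK (p.1, n * p.2 + j), e i⟫_ℂ‖ = ‖⟪bL (-p), W (bK (0, j)) i⟫_ℂ‖) :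
    ∑' i : ℕ, ENNReal.ofReal (‖e i‖ ^ 2) = n := by
  have h1 : ∀ i, ENNReal.ofReal (‖e i‖ ^ 2) =
      ∑ j ∈ Finset.range n, ENNReal.ofReal (‖W (bK (0, (j : ℤ))) i‖ ^ 2) := by
    intro i
    rw [← bK.tsum_ofReal_norm_inner_sq, tsum_int_prod_eq_sum_range n hn]
    refine Finset.sum_congr rfl fun j _ => ?_
    simp only [he]
    rw [← bL.tsum_ofReal_norm_inner_sq]
    exact (Equiv.neg (ℤ × ℤ)).tsum_eq fun p =>
      ENNReal.ofReal (‖⟪bL p, W (bK (0, (j : ℤ))) i⟫_ℂ‖ ^ 2)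
  have h2 : ∀ j : ℕ, ∑' i, ENNReal.ofReal (‖W (bK (0, (j : ℤ))) i‖ ^ 2) = 1 := by
    intro j
    have hs := lp.hasSum_norm (p := 2) (by norm_num) (W (bK (0, (j : ℤ))))
    rw [W.norm_map, bK.orthonormal.1] at hs
    have hs' : HasSum (fun i => ‖W (bK (0, (j : ℤ))) i‖ ^ 2) 1 := by simpa using hs
    rw [← ENNReal.ofReal_tsum_of_nonneg (fun i => by positivity) hs'.summable, hs'.tsum_eq,
      ENNReal.ofReal_one]
  simp only [h1]
  rw [Summable.tsum_finsetSum fun _ _ => ENNReal.summable]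
  rw [Finset.sum_congr rfl fun j _ => h2 j]
  simp

end Parseval

namespace VonNeumannAlgebra

variable {H : Type w} [NormedAddCommGroup H] [InnerProductSpace ℂ H] [CompleteSpace H]
  {N R : VonNeumannAlgebra H} {τ : R →ₚ[ℂ] ℂ}

theorem inner_gnsStarAlgHom_right (τ : R →ₚ[ℂ] ℂ) (x : R) (ξ η : τ.GNS) :
    ⟪ξ, τ.gnsStarAlgHom x η⟫_ℂ = ⟪τ.gnsStarAlgHom (star x) ξ, η⟫_ℂ := by
  have h : τ.gnsStarAlgHom (star x) = (τ.gnsStarAlgHom x).adjoint := map_star τ.gnsStarAlgHom x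
  rw [h, ContinuousLinearMap.adjoint_inner_left]

theorem inner_gnsStarAlgHom_gnsHat_one (τ : R →ₚ[ℂ] ℂ) (x : R) (ξ : τ.GNS) :
    ⟪τ.gnsStarAlgHom x ξ, gnsHat τ 1⟫_ℂ = ⟪ξ, gnsHat τ (star x)⟫_ℂ := by
  have h : τ.gnsStarAlgHom (star x) = (τ.gnsStarAlgHom x).adjoint := map_star τ.gnsStarAlgHom x
  have h1 : gnsHat τ (star x) = τ.gnsStarAlgHom (star x) (gnsHat τ 1) := by
    rw [gnsStarAlgHom_gnsHat, mul_one]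
  rw [h1, h, ContinuousLinearMap.adjoint_inner_right]

theorem IsTrace.norm_gnsHat_incl_mul (hτ : IsTrace τ) (hN : N ≤ R) {y : R} (hy : y * star y = 1)
    (x : N) : ‖gnsHat τ (incl hN x * y)‖ = ‖gnsHat (VonNeumannAlgebra.restrict hN τ) x‖ := by
  have h1 : ‖gnsHat τ (incl hN x * y)‖ ^ 2 = ‖gnsHat (VonNeumannAlgebra.restrict hN τ) x‖ ^ 2 := by
    apply Complex.ofReal_injective
    rw [norm_gnsHat_sq, norm_gnsHat_sq, ← inner_gnsHat, hτ.inner_gnsHat_mul_right, hy, mul_one,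
      inner_gnsHat]
    rfl
  exact (pow_left_inj₀ (norm_nonneg _) (norm_nonneg _) two_ne_zero).1 h1

/-- The map `x̂ ↦ (x y)^` from `L²(N, τ)` to `L²(R, τ)`, for a unitary `y` of `R`. -/
theorem IsTrace.exists_rightMul (hτ : IsTrace τ) (hN : N ≤ R) {y : R} (hy : y * star y = 1) :
    ∃ E : (VonNeumannAlgebra.restrict hN τ).GNS →L[ℂ] τ.GNS,
      ∀ x : N, E (gnsHat (VonNeumannAlgebra.restrict hN τ) x) = gnsHat τ (incl hN x * y) := by
  let σ := VonNeumannAlgebra.restrict hN τ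
  let f₀ : σ.PreGNS →ₗ[ℂ] τ.GNS :=
    (gnsHat τ).comp ((LinearMap.mulRight ℂ y).comp
      ((incl hN).toAlgHom.toLinearMap.comp σ.ofPreGNS.toLinearMap))
  let f : σ.PreGNS →L[ℂ] τ.GNS := f₀.mkContinuous 1 fun x => by
    rw [one_mul]
    exact ((hτ.norm_gnsHat_incl_mul hN hy (σ.ofPreGNS x)).trans
      (UniformSpace.Completion.norm_coe x)).le
  refine ⟨f.extend (UniformSpace.Completion.toComplL (𝕜 := ℂ) (E := σ.PreGNS)), fun x => ?_⟩
  exact f.extend_eq (e := UniformSpace.Completion.toComplL (𝕜 := ℂ) (E := σ.PreGNS))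
    (UniformSpace.Completion.denseRange_coe (α := σ.PreGNS))
    (UniformSpace.Completion.isUniformInducing_coe (α := σ.PreGNS)) (σ.toPreGNS x)

/-- Right multiplication by an element of `R` intertwines the left actions of `N`, and so does its
adjoint. -/
theorem adjoint_rightMul_intertwines (hN : N ≤ R) {y : R}
    {E : (VonNeumannAlgebra.restrict hN τ).GNS →L[ℂ] τ.GNS}
    (hE : ∀ x : N, E (gnsHat (VonNeumannAlgebra.restrict hN τ) x) = gnsHat τ (incl hN x * y))
    (a : N) (ξ : τ.GNS) :
    E.adjoint (τ.gnsStarAlgHom (incl hN a) ξ) =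
      (VonNeumannAlgebra.restrict hN τ).gnsStarAlgHom a (E.adjoint ξ) := by
  let σ := VonNeumannAlgebra.restrict hN τ
  have h1 : ∀ (a : N) ξ, E (σ.gnsStarAlgHom a ξ) = τ.gnsStarAlgHom (incl hN a) (E ξ) := by
    intro a ξ
    refine (gnsHat_denseRange σ).induction_on (p := fun ξ => E (σ.gnsStarAlgHom a ξ) =
      τ.gnsStarAlgHom (incl hN a) (E ξ)) ξ (isClosed_eq (by fun_prop) (by fun_prop)) fun x => ?_
    rw [gnsStarAlgHom_gnsHat, hE, hE, gnsStarAlgHom_gnsHat, map_mul (incl hN), mul_assoc]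
  refine ext_inner_left ℂ fun η => ?_
  rw [ContinuousLinearMap.adjoint_inner_right, inner_gnsStarAlgHom_right,
    inner_gnsStarAlgHom_right, ContinuousLinearMap.adjoint_inner_right, h1]
  rfl

/-- The coefficients of the vectors that enter the trace of the projection of a realization `W`. -/
theorem inner_adjoint_single {σ : N →ₚ[ℂ] ℂ} (hN : N ≤ R)
    (W : τ.GNS →ₗᵢ[ℂ] lp (fun _ : ℕ => σ.GNS) 2)
    (hW : ∀ (y : N) (ξ : τ.GNS) (i : ℕ),
      W ((τ.gnsStarAlgHom.comp (incl hN)) y ξ) i = σ.gnsStarAlgHom y (W ξ i))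
    (y : N) (ζ : τ.GNS) (i : ℕ) :
    ⟪τ.gnsStarAlgHom (incl hN y) ζ, W.toContinuousLinearMap.adjoint
      (lp.single 2 i (gnsVector σ))⟫_ℂ = ⟪W ζ i, gnsHat σ (star y)⟫_ℂ := by
  have h1 : W (τ.gnsStarAlgHom (incl hN y) ζ) i = σ.gnsStarAlgHom y (W ζ i) := hW y ζ i
  rw [ContinuousLinearMap.adjoint_inner_right, LinearIsometry.coe_toContinuousLinearMap]
  refine (lp.inner_single_right i _ _).trans ?_
  rw [h1]
  exact inner_gnsStarAlgHom_gnsHat_one _ y (W ζ i)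

section Index

variable {U V : unitary (H →L[ℂ] H)} {c : Circle} {n : ℕ}

theorem rotationWord_pow_mul (U V : unitary (H →L[ℂ] H)) (n : ℕ) (p : ℤ × ℤ) (j : ℕ) :
    rotationWord U (V ^ n) p * V ^ j = rotationWord U V (p.1, n * p.2 + j) := by
  simp only [rotationWord, zpow_add, zpow_mul, zpow_natCast, mul_assoc]

theorem incl_wordIn_mul (hN : N ≤ R) (hUN : (U : H →L[ℂ] H) ∈ N)
    (hVN : ((V ^ n : unitary (H →L[ℂ] H)) : H →L[ℂ] H) ∈ N)
    (hU : (U : H →L[ℂ] H) ∈ R) (hV : (V : H →L[ℂ] H) ∈ R) (p : ℤ × ℤ) (j : ℕ) :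
    incl hN (wordIn hUN hVN p) * wordIn hU hV (0, j) = wordIn hU hV (p.1, n * p.2 + j) := by
  refine Subtype.ext ?_
  have := congrArg (fun x : unitary (H →L[ℂ] H) => (x : H →L[ℂ] H)) (rotationWord_pow_mul U V n p j)
  have h0 : rotationWord U V (0, (j : ℤ)) = V ^ j := by simp [rotationWord]
  rw [← h0] at this
  exact this

set_option maxHeartbeats 1000000 in
/-- For every realization `W` of `L²(R)` in `ℓ² ⊗ L²(N)` the trace of the projection `W W*` is `n`,
by Parseval's identity for the orthonormal bases `Uᵃ Vⁿᵏ Vʲ`, `j < n`, of `L²(R)`, and `Uᵃ Vⁿᵏ` of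
`L²(N)`. -/
theorem tsum_norm_adjoint_single_sq {σ : N →ₚ[ℂ] ℂ} (hn : n ≠ 0) (hN : N ≤ R)
    (h : IsRotationPair U V c)
    (hUN : (U : H →L[ℂ] H) ∈ N) (hVN : ((V ^ n : unitary (H →L[ℂ] H)) : H →L[ℂ] H) ∈ N)
    (hU : (U : H →L[ℂ] H) ∈ R) (hV : (V : H →L[ℂ] H) ∈ R)
    (bR : HilbertBasis (ℤ × ℤ) ℂ τ.GNS) (hbR : ∀ p, bR p = gnsHat τ (wordIn hU hV p))
    (bN : HilbertBasis (ℤ × ℤ) ℂ σ.GNS) (hbN : ∀ p, bN p = gnsHat σ (wordIn hUN hVN p))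
    (W : τ.GNS →ₗᵢ[ℂ] lp (fun _ : ℕ => σ.GNS) 2)
    (hW : ∀ (y : N) (ξ : τ.GNS) (i : ℕ),
      W ((τ.gnsStarAlgHom.comp (incl hN)) y ξ) i = σ.gnsStarAlgHom y (W ξ i)) :
    ∑' i : ℕ, ENNReal.ofReal
      (‖W.toContinuousLinearMap.adjoint (lp.single 2 i (gnsVector σ))‖ ^ 2) = n := by
  have hbRN : ∀ (p : ℤ × ℤ) (j : ℕ), bR (p.1, n * p.2 + j) =
      τ.gnsStarAlgHom (incl hN (wordIn hUN hVN p)) (bR (0, j)) := by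
    intro p j
    rw [hbR, hbR, gnsStarAlgHom_gnsHat, incl_wordIn_mul hN hUN hVN hU hV]
  have hcoeff : ∀ (i j : ℕ) (p : ℤ × ℤ),
      ‖⟪bR (p.1, n * p.2 + j), W.toContinuousLinearMap.adjoint
        (lp.single 2 i (gnsVector σ))⟫_ℂ‖ = ‖⟪bN (-p), W (bR (0, j)) i⟫_ℂ‖ := by
    intro i j p
    obtain ⟨d, hd⟩ := star_wordIn (h.pow hn) hUN hVN p
    have h1 := inner_adjoint_single hN W hW (wordIn hUN hVN p) (bR (0, j)) i
    have h2 : gnsHat σ (star (wordIn hUN hVN p)) = (d : ℂ) • bN (-p) := by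
      rw [hd, hbN]
      exact LinearMap.map_smul _ _ _
    rw [← hbRN, h2] at h1
    refine (congrArg norm h1).trans ?_
    rw [inner_smul_right, norm_mul, Circle.norm_coe, one_mul, norm_inner_symm]
  exact tsum_norm_sq_of_basis hn bR bN W _ hcoeff

/-- The maps `x̂ ↦ (x Vʲ)^`, `j < n`, identify `L²(R)` with the sum of `n` copies of `L²(N)`. -/
theorem exists_realization (hτ : IsTrace τ) (hn : n ≠ 0) (hN : N ≤ R)
    (hUN : (U : H →L[ℂ] H) ∈ N) (hVN : ((V ^ n : unitary (H →L[ℂ] H)) : H →L[ℂ] H) ∈ N)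
    (hU : (U : H →L[ℂ] H) ∈ R) (hV : (V : H →L[ℂ] H) ∈ R)
    (bR : HilbertBasis (ℤ × ℤ) ℂ τ.GNS) (hbR : ∀ p, bR p = gnsHat τ (wordIn hU hV p))
    (bN : HilbertBasis (ℤ × ℤ) ℂ (VonNeumannAlgebra.restrict hN τ).GNS)
    (hbN : ∀ p, bN p = gnsHat (VonNeumannAlgebra.restrict hN τ) (wordIn hUN hVN p)) :
    ∃ W : τ.GNS →ₗᵢ[ℂ] lp (fun _ : ℕ => (VonNeumannAlgebra.restrict hN τ).GNS) 2,
      ∀ (y : N) (ξ : τ.GNS) (i : ℕ), W ((τ.gnsStarAlgHom.comp (incl hN)) y ξ) i =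
        (VonNeumannAlgebra.restrict hN τ).gnsStarAlgHom y (W ξ i) := by
  choose E hE using fun j : ℕ => hτ.exists_rightMul hN
    (y := wordIn hU hV (0, (j : ℤ))) (coe_mul_star_self _ _)
  have hint := fun j => adjoint_rightMul_intertwines hN (hE j)
  have hEb : ∀ (j : ℕ) (p : ℤ × ℤ), E j (bN p) = bR (p.1, n * p.2 + j) := fun j p => by
    rw [hbN, hE, incl_wordIn_mul hN hUN hVN hU hV, hbR]
  obtain ⟨W, hW⟩ := exists_linearIsometry_of_basis hn bR bN E hEb
  refine ⟨W, fun y ξ i => ?_⟩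
  rw [hW, hW]
  split_ifs
  · exact hint i y ξ
  · exact (map_zero _).symm

/-- The Jones index of `{U, Vⁿ}''` in `{U, V}''` is `n`. -/
theorem jonesIndex_eq (hτ : IsTrace τ) (h : IsRotationPair U V c) (hn : n ≠ 0)
    (hR : generatedBy {(U : H →L[ℂ] H), (V : H →L[ℂ] H)} = R)
    (hNgen : generatedBy {(U : H →L[ℂ] H), ((V ^ n : unitary (H →L[ℂ] H)) : H →L[ℂ] H)} = N)
    (hN : N ≤ R) : jonesIndex τ N hN = n := by
  obtain ⟨hU, hV⟩ := mem_of_generatedBy_eq hR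
  obtain ⟨hUN, hVN⟩ := mem_of_generatedBy_eq hNgen
  have hσ := hτ.restrict hN
  have hbR := hτ.wordBasis_apply h hU hV hR
  have hbN := hσ.wordBasis_apply (h.pow hn) hUN hVN hNgen
  have hsum := tsum_norm_adjoint_single_sq hn hN h hUN hVN hU hV _ hbR _ hbN
  obtain ⟨W, hW⟩ := exists_realization hτ hn hN hUN hVN hU hV _ hbR _ hbN
  exact le_antisymm ((iInf₂_le W hW).trans (hsum W hW).le) (le_iInf₂ fun W hW => (hsum W hW).ge)

end Index

end VonNeumannAlgebra

/-! ### The von Neumann algebra of a weighted unitary -/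

section Weighted

open VonNeumannAlgebra

variable {H : Type w} [NormedAddCommGroup H] [InnerProductSpace ℂ H] [CompleteSpace H]
  {N M R : VonNeumannAlgebra H} {U v : unitary (H →L[ℂ] H)} {c : Circle} {f g : Circle → ℂ}
  {P T : H →L[ℂ] H}

/-- A positive operator is the square root of its square, hence belongs to every von Neumann algebra
that contains `U P`. -/
theorem VonNeumannAlgebra.mem_of_unitary_mul_mem (hP : 0 ≤ P) (h : (U : H →L[ℂ] H) * P ∈ M) :
    P ∈ M := by
  have hsq : P * P ∈ M := by
    have h1 : star ((U : H →L[ℂ] H) * P) * ((U : H →L[ℂ] H) * P) ∈ M := mul_mem (star_mem h) h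
    rwa [star_mul, (IsSelfAdjoint.of_nonneg hP).star_eq, mul_assoc, ← mul_assoc (star _),
      Unitary.coe_star_mul_self, one_mul] at h1
  have h2 : cfc Real.sqrt (P * P) = P := by
    have hsa := IsSelfAdjoint.of_nonneg hP
    rw [← pow_two, ← cfc_pow_id (R := ℝ) P 2 hsa, ← cfc_comp' Real.sqrt (fun x : ℝ => x ^ 2) P]
    conv_rhs => rw [← cfc_id ℝ P hsa]
    exact cfc_congr fun t ht => Real.sqrt_sq (spectrum_nonneg_of_nonneg hP ht)
  rw [← h2]
  have := isClosed_coe M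
  exact cfc_mem _ hsq

/-- The unitary part of an injective operator `U P` belongs to `{U P}''`. -/
theorem VonNeumannAlgebra.unitary_mem_of_mul_mem (hP : 0 ≤ P) (hinj : ∀ ξ, P ξ = 0 → ξ = 0)
    (h : (U : H →L[ℂ] H) * P ∈ M) : (U : H →L[ℂ] H) ∈ M := by
  have hPM := mem_of_unitary_mul_mem hP h
  rw [← VonNeumannAlgebra.commutant_commutant M, VonNeumannAlgebra.mem_commutant_iff]
  intro y hy
  rw [VonNeumannAlgebra.mem_commutant_iff] at hy
  have h1 : (y * U - U * y) * P = 0 := by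
    rw [sub_mul, mul_assoc, mul_assoc, ← hy P hPM, ← hy _ h, mul_assoc, sub_self]
  have h2 : P * star (y * U - U * y) = 0 := by
    rw [← (IsSelfAdjoint.of_nonneg hP).star_eq, ← star_mul, h1, star_zero]
  have h3 : star (y * U - U * y) = 0 := by
    ext ξ
    exact hinj _ (DFunLike.congr_fun h2 ξ)
  exact sub_eq_zero.1 (star_eq_zero.1 h3)

namespace IsLinftyCalc

theorem sum {ι : Type*} (s : Finset ι) {F : ι → Circle → ℂ} {S : ι → H →L[ℂ] H}
    (h : ∀ i, IsLinftyCalc v (F i) (S i)) :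
    IsLinftyCalc v (fun z => ∑ i ∈ s, F i z) (∑ i ∈ s, S i) := by
  classical
  induction s using Finset.induction_on with
  | empty =>
    have := isLinftyCalc_circleCalc v 0
    rw [map_zero] at this
    simp only [Finset.sum_empty]
    exact this
  | insert i s hi ih =>
    simp only [Finset.sum_insert hi]
    exact (h i).add ih

/-- The matrix coefficients `⟨ξ, |f|(v) ξ⟩` are integrals of `|f|`. -/
theorem nonneg (hac : ∀ ξ, spectralMeasure v ξ ≪ circleMeasure)
    (h : IsLinftyCalc v (fun z => ((‖f z‖ : ℝ) : ℂ)) P) : 0 ≤ P := by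
  rw [ContinuousLinearMap.nonneg_iff_isPositive, ContinuousLinearMap.isPositive_iff_complex]
  intro ξ
  have h1 : ⟪P ξ, ξ⟫_ℂ = ((∫ z, ‖f z‖ ∂(spectralMeasure v ξ) : ℝ) : ℂ) := by
    rw [← inner_conj_symm, (h.integrable_and_inner hac ξ).2, integral_complex_ofReal,
      Complex.conj_ofReal]
  rw [h1]
  exact ⟨rfl, integral_nonneg fun z => norm_nonneg _⟩

/-- If `U` rotates `v` irrationally, then an algebra containing `U` and `g(v)` contains `vʲ` for
every frequency `j` of `g`: the twisted averages of the conjugates of `g(v)` by powers of `U`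
converge to a multiple of `vʲ`. -/
theorem zpow_mem_of_circleCoeff_ne_zero (hac : ∀ ξ, spectralMeasure v ξ ≪ circleMeasure)
    (hr : IsRotationPair U v c) (h : IsLinftyCalc v g T) (hg : MemLp g ∞ circleMeasure)
    (hU : (U : H →L[ℂ] H) ∈ N) (hT : T ∈ N) {j : ℤ} (hj : circleCoeff g j ≠ 0) :
    ((v ^ j : unitary (H →L[ℂ] H)) : H →L[ℂ] H) ∈ N := by
  obtain ⟨ns, hns⟩ := exists_ergodic_average_tendsto_ae (hg.mono_exponent le_top) hr.irrational j
  have hconj : ∀ k : ℕ, IsLinftyCalc v (fun z => g (c ^ k * z))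
      (star ((U ^ k : unitary (H →L[ℂ] H)) : H →L[ℂ] H) * T *
        ((U ^ k : unitary (H →L[ℂ] H)) : H →L[ℂ] H)) := fun k =>
    h.conj (U ^ k) (c ^ k) (by simpa using hr.zpow_comm k 1)
  have hUk : ∀ k : ℕ, ((U ^ k : unitary (H →L[ℂ] H)) : H →L[ℂ] H) ∈ N := fun k => by
    simpa using pow_mem hU k
  have hterm : ∀ i, IsLinftyCalc v (fun z => (ns i : ℂ)⁻¹ *
      ∑ k ∈ Finset.range (ns i), circleMonomial (-j) (c ^ k) * g (c ^ k * z))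
      ((ns i : ℂ)⁻¹ • ∑ k ∈ Finset.range (ns i), circleMonomial (-j) (c ^ k) •
        (star ((U ^ k : unitary (H →L[ℂ] H)) : H →L[ℂ] H) * T *
          ((U ^ k : unitary (H →L[ℂ] H)) : H →L[ℂ] H))) := fun i =>
    (sum _ fun k => (hconj k).const_smul _).const_smul _
  have hlim : IsLinftyCalc v (fun z => circleCoeff g j * circleMonomial j z)
      (circleCoeff g j • ((v ^ j : unitary (H →L[ℂ] H)) : H →L[ℂ] H)) := by
    rw [← circleCalc_monomial]
    exact (isLinftyCalc_circleCalc v _).const_smul _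
  -- the averages are uniformly bounded, so dominated convergence applies
  let C : ℝ := lpNorm g ∞ circleMeasure
  have hC0 : 0 ≤ C := lpNorm_nonneg
  have hC : ∀ᵐ z ∂circleMeasure, ∀ k : ℕ, ‖g (c ^ k * z)‖ ≤ C := ae_all_iff.2 fun k =>
    (measurePreserving_circle_mul (c ^ k)).quasiMeasurePreserving.ae
      (ae_le_lpNorm_exponent_top hg)
  have hbound : ∀ i, ∀ᵐ z ∂circleMeasure, ‖(ns i : ℂ)⁻¹ *
      ∑ k ∈ Finset.range (ns i), circleMonomial (-j) (c ^ k) * g (c ^ k * z) -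
      circleCoeff g j * circleMonomial j z‖ ≤ C + ‖circleCoeff g j‖ := by
    intro i
    filter_upwards [hC] with z hz
    refine (norm_sub_le _ _).trans (add_le_add ?_ ?_)
    · have h1 : ‖∑ k ∈ Finset.range (ns i), circleMonomial (-j) (c ^ k) * g (c ^ k * z)‖ ≤
          ns i * C := by
        refine (norm_sum_le_of_le _ (n := fun _ => C) fun k _ => ?_).trans (by simp)
        rw [norm_mul, circleMonomial_apply, Circle.norm_coe, one_mul]
        exact hz k
      rw [norm_mul, norm_inv, Complex.norm_natCast]
      refine (mul_le_mul_of_nonneg_left h1 (by positivity)).trans ?_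
      rw [← mul_assoc]
      exact mul_le_of_le_one_left hC0 (inv_mul_le_one (a := (ns i : ℝ)))
    · rw [norm_mul, circleMonomial_apply, Circle.norm_coe, mul_one]
  have hmem : circleCoeff g j • ((v ^ j : unitary (H →L[ℂ] H)) : H →L[ℂ] H) ∈ N :=
    N.mem_of_strong_tendsto (fun i => SMulMemClass.smul_mem _ (sum_mem fun k _ =>
      SMulMemClass.smul_mem _ (mul_mem (mul_mem (star_mem (hUk k)) hT) (hUk k))))
      (tendsto_of_tendsto_ae hac hterm hlim hbound hns)
  have := SMulMemClass.smul_mem (circleCoeff g j)⁻¹ hmem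
  rwa [inv_smul_smul₀ hj] at this

end IsLinftyCalc

/-- Averaging a continuous function over the rotations by the powers of `ζ`. -/
noncomputable def circleAverage (n : ℕ) (ζ : Circle) : C(Circle, ℂ) →L[ℂ] C(Circle, ℂ) :=
  (n : ℂ)⁻¹ • ∑ i ∈ Finset.range n,
    { toFun := fun k => k.comp ⟨fun z => ζ ^ i * z, continuous_const_mul _⟩
      map_add' := fun _ _ => rfl
      map_smul' := fun _ _ => rfl
      cont := ContinuousMap.continuous_precomp _ }

theorem circleAverage_apply (n : ℕ) (ζ : Circle) (g : C(Circle, ℂ)) (z : Circle) :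
    circleAverage n ζ g z = (n : ℂ)⁻¹ * ∑ i ∈ Finset.range n, g (ζ ^ i * z) := by
  simp [circleAverage]

theorem norm_circleAverage_le (n : ℕ) (ζ : Circle) (g : C(Circle, ℂ)) :
    ‖circleAverage n ζ g‖ ≤ ‖g‖ := by
  refine (ContinuousMap.norm_le _ (norm_nonneg _)).2 fun z => ?_
  have h1 : ‖∑ i ∈ Finset.range n, g (ζ ^ i * z)‖ ≤ n * ‖g‖ :=
    (norm_sum_le_of_le _ (n := fun _ => ‖g‖) fun k _ => g.norm_coe_le_norm _).trans (by simp)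
  rw [circleAverage_apply, norm_mul, norm_inv, Complex.norm_natCast]
  refine (mul_le_mul_of_nonneg_left h1 (by positivity)).trans ?_
  rw [← mul_assoc]
  exact mul_le_of_le_one_left (norm_nonneg _) (inv_mul_le_one (a := (n : ℝ)))

theorem circleAverage_monomial {n : ℕ} (hn : n ≠ 0) {ζ : Circle} (hζ : IsPrimitiveRoot ζ n)
    (l : ℤ) :
    circleAverage n ζ (circleMonomial l) = if (n : ℤ) ∣ l then circleMonomial l else 0 := by
  have hn' : (n : ℂ) ≠ 0 := Nat.cast_ne_zero.2 hn
  ext z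
  have h1 : ∀ i : ℕ, circleMonomial l (ζ ^ i * z) =
      ((ζ ^ l : Circle) : ℂ) ^ i * circleMonomial l z := by
    intro i
    have h0 : (ζ ^ i) ^ l = (ζ ^ l) ^ i := by
      rw [← zpow_natCast, ← zpow_natCast, zpow_comm]
    rw [circleMonomial_mul_left, circleMonomial_apply _ (ζ ^ i), h0, Circle.coe_pow]
  rw [circleAverage_apply]
  simp only [h1]
  rw [← Finset.sum_mul]
  split_ifs with hl
  · rw [(hζ.zpow_eq_one_iff_dvd l).2 hl]
    simp [hn']
  · have h2 : ((ζ ^ l : Circle) : ℂ) ≠ 1 := fun h =>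
      hl ((hζ.zpow_eq_one_iff_dvd l).1 (Circle.ext (by simpa using h)))
    have h3 : ((ζ ^ l : Circle) : ℂ) ^ n = 1 := by
      rw [← Circle.coe_pow, ← zpow_natCast, ← zpow_mul, mul_comm, zpow_mul, zpow_natCast,
        hζ.pow_eq_one, one_zpow, Circle.coe_one]
    rw [geom_sum_eq h2, h3]
    simp

/-- If the frequencies of `g` are multiples of `n`, then `g(v)` belongs to `{vⁿ}''`. -/
theorem IsLinftyCalc.mem_of_circleCoeff_eq_zero (hac : ∀ ξ, spectralMeasure v ξ ≪ circleMeasure)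
    (h : IsLinftyCalc v g T) (hg : MemLp g ∞ circleMeasure) {n : ℕ} (hn : n ≠ 0)
    (hcoeff : ∀ j : ℤ, ¬ (n : ℤ) ∣ j → circleCoeff g j = 0)
    (hv : ((v ^ n : unitary (H →L[ℂ] H)) : H →L[ℂ] H) ∈ N) : T ∈ N := by
  have hn' : (n : ℂ) ≠ 0 := Nat.cast_ne_zero.2 hn
  obtain ⟨ζ, hζ⟩ : ∃ ζ : Circle, IsPrimitiveRoot ζ n := by
    refine ⟨Circle.exp (2 * Real.pi / n), ?_⟩
    refine IsPrimitiveRoot.of_map_of_injective (f := Circle.coeHom) ?_ Circle.coe_injective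
    convert Complex.isPrimitiveRoot_exp n hn using 1
    change ((Circle.exp _ : Circle) : ℂ) = _
    rw [Circle.coe_exp]
    congr 1
    push_cast
    ring
  -- averaging over the `n`-th roots of unity keeps only the frequencies divisible by `n`
  have hmem : ∀ k : C(Circle, ℂ), circleCalc v (circleAverage n ζ k) ∈ N := by
    refine mem_of_isClosed_of_circleMonomial_mem
      (S := Submodule.comap ((circleCalcCLM v).comp (circleAverage n ζ)).toLinearMap
        N.toStarSubalgebra.toSubalgebra.toSubmodule)
      ((isClosed_coe N).preimage ((circleCalcCLM v).comp (circleAverage n ζ)).continuous)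
      (fun l => ?_)
    change circleCalc v (circleAverage n ζ (circleMonomial l)) ∈ N
    rw [circleAverage_monomial hn hζ]
    split_ifs with hl
    · obtain ⟨k, rfl⟩ := hl
      rw [circleCalc_monomial, zpow_mul, zpow_natCast]
      exact zpow_mem hv k
    · rw [map_zero]; exact zero_mem N
  -- `g` is equal to its average, so the averages of continuous approximations converge to `g`
  obtain ⟨k, C, hC, hk, hT⟩ := h
  have hrot : ∀ᵐ z ∂circleMeasure, ∀ i : ℕ, g (ζ ^ i * z) = g z := ae_all_iff.2 fun i =>
    ae_eq_rotate_of_circleCoeff (hg.mono_exponent le_top) hcoeff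
      (by rw [← pow_mul, mul_comm, pow_mul, hζ.pow_eq_one, one_pow])
  have hk' : ∀ᵐ z ∂circleMeasure, ∀ i : ℕ, Tendsto (fun m => k m (ζ ^ i * z)) atTop
      (𝓝 (g (ζ ^ i * z))) := ae_all_iff.2 fun i =>
    (measurePreserving_circle_mul (ζ ^ i)).quasiMeasurePreserving.ae hk
  have hlim : ∀ᵐ z ∂circleMeasure, Tendsto (fun m => circleAverage n ζ (k m) z) atTop
      (𝓝 (g z)) := by
    filter_upwards [hrot, hk'] with z h1 h2
    have h3 := (tendsto_finsetSum (Finset.range n) fun i _ => h2 i).const_mul (n : ℂ)⁻¹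
    simp only [h1, Finset.sum_const, Finset.card_range, nsmul_eq_mul,
      inv_mul_cancel_left₀ hn'] at h3
    simpa only [circleAverage_apply] using h3
  have hC' : ∀ m, ‖circleAverage n ζ (k m)‖ ≤ C := fun m =>
    (norm_circleAverage_le _ _ _).trans (hC m)
  obtain ⟨S, hS⟩ := exists_strong_limit v hC' fun ξ => (hac ξ).ae_le hlim
  have hST : S = T := IsLinftyCalc.unique (f := g) hac ⟨_, C, hC', hlim, hS⟩ ⟨k, C, hC, hk, hT⟩
  rw [← hST]
  exact N.mem_of_strong_tendsto (fun m => hmem (k m)) hS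

/-- For `N = {U, g(v)}''` the exponents `j` with `vʲ ∈ N` form a subgroup of `ℤ`, generated by some
`n`; it is nontrivial as `g(v)` is not a scalar, and all frequencies of `g` belong to it. Hence
`N = {U, vⁿ}''`. -/
theorem IsLinftyCalc.exists_generatedBy_eq (hac : ∀ ξ, spectralMeasure v ξ ≪ circleMeasure)
    (hr : IsRotationPair U v c) (h : IsLinftyCalc v g T) (hg : MemLp g ∞ circleMeasure)
    (hconst : ∀ a : ℂ, T ≠ a • (1 : H →L[ℂ] H))
    (hU : (U : H →L[ℂ] H) ∈ N) (hT : T ∈ N)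
    (hN : ∀ M : VonNeumannAlgebra H, (U : H →L[ℂ] H) ∈ M → T ∈ M → N ≤ M) :
    ∃ n : ℕ, n ≠ 0 ∧
      generatedBy {(U : H →L[ℂ] H), ((v ^ n : unitary (H →L[ℂ] H)) : H →L[ℂ] H)} = N := by
  let G : AddSubgroup ℤ :=
    { carrier := {j | ((v ^ j : unitary (H →L[ℂ] H)) : H →L[ℂ] H) ∈ N}
      zero_mem' := by
        change ((v ^ (0 : ℤ) : unitary (H →L[ℂ] H)) : H →L[ℂ] H) ∈ N
        rw [zpow_zero]; exact one_mem N
      add_mem' := fun {a b} ha hb => by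
        change ((v ^ (a + b) : unitary (H →L[ℂ] H)) : H →L[ℂ] H) ∈ N
        rw [zpow_add]; exact mul_mem ha hb
      neg_mem' := fun {a} ha => by
        change ((v ^ (-a) : unitary (H →L[ℂ] H)) : H →L[ℂ] H) ∈ N
        rw [zpow_neg, ← Unitary.star_eq_inv]; exact star_mem ha }
  obtain ⟨a, ha⟩ := Int.subgroup_cyclic G
  have hG : ∀ j : ℤ, ((v ^ j : unitary (H →L[ℂ] H)) : H →L[ℂ] H) ∈ N ↔ (a.natAbs : ℤ) ∣ j := by
    intro j
    change j ∈ G ↔ _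
    rw [ha, AddSubgroup.mem_closure_singleton, Int.natAbs_dvd]
    simp only [smul_eq_mul, Dvd.dvd, mul_comm, eq_comm]
  have hcoeff : ∀ j : ℤ, ¬ (a.natAbs : ℤ) ∣ j → circleCoeff g j = 0 := fun j hj => by
    by_contra h0
    exact hj ((hG j).1 (h.zpow_mem_of_circleCoeff_ne_zero hac hr hg hU hT h0))
  have ha0 : a.natAbs ≠ 0 := by
    intro h0
    rw [h0] at hcoeff
    -- all nonzero frequencies of `g` have coefficient zero, so `g` is constant
    have hgc : g =ᵐ[circleMeasure] (circleCoeff g 0 • circleMonomial 0 : C(Circle, ℂ)) := by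
      refine ae_eq_of_circleCoeff_eq (hg.mono_exponent le_top)
        (MemLp.of_bound (ContinuousMap.continuous _).aestronglyMeasurable _
          (Eventually.of_forall fun z => ContinuousMap.norm_coe_le_norm _ z)) fun j => ?_
      have h1 : circleCoeff (circleCoeff g 0 • circleMonomial 0 : C(Circle, ℂ)) j =
          circleCoeff g 0 * circleCoeff (circleMonomial 0) j :=
        (integral_congr_ae (Eventually.of_forall fun z => mul_assoc _ _ _)).trans
          (integral_const_mul _ _)
      rw [h1, circleCoeff_monomial]
      split_ifs with hj
      · rw [← hj, mul_one]
      · rw [mul_zero]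
        exact hcoeff j fun h0 => hj (zero_dvd_iff.1 (by simpa using h0)).symm
    have h1 : IsLinftyCalc v g (circleCoeff g 0 • (1 : H →L[ℂ] H)) := by
      have := isLinftyCalc_circleCalc v (circleCoeff g 0 • circleMonomial 0)
      rw [map_smul, circleMonomial_zero, map_one] at this
      exact this.congr_ae (by rw [← circleMonomial_zero]; exact hgc.symm)
    exact hconst _ (h.unique hac h1)
  have hvn : ((v ^ a.natAbs : unitary (H →L[ℂ] H)) : H →L[ℂ] H) ∈ N := by
    rw [← zpow_natCast]; exact (hG _).2 dvd_rfl
  refine ⟨a.natAbs, ha0, le_antisymm (generatedBy_le ?_) (hN _ ?_ ?_)⟩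
  · rintro x (rfl | rfl)
    exacts [hU, hvn]
  · exact subset_generatedBy _ (Set.mem_insert _ _)
  · exact h.mem_of_circleCoeff_eq_zero hac hg ha0 hcoeff
      (subset_generatedBy _ (Set.mem_insert_of_mem _ rfl))

end Weighted

/-! ### The phase of a function -/

section Phase

variable {f : Circle → ℂ}

open Classical in
/-- The phase `f / |f|` of a function, with value `1` at the zeros of `f`. -/
noncomputable def phase (f : Circle → ℂ) (z : Circle) : ℂ :=
  if f z = 0 then 1 else f z / ‖f z‖

theorem norm_phase (f : Circle → ℂ) (z : Circle) : ‖phase f z‖ = 1 := by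
  unfold phase
  split_ifs with h
  · exact norm_one
  · rw [norm_div, Complex.norm_real, norm_norm, div_self (norm_ne_zero_iff.2 h)]

theorem phase_mul_norm (f : Circle → ℂ) (z : Circle) : phase f z * ((‖f z‖ : ℝ) : ℂ) = f z := by
  unfold phase
  split_ifs with h
  · rw [h]; simp
  · exact div_mul_cancel₀ _ (Complex.ofReal_ne_zero.2 (norm_ne_zero_iff.2 h))

theorem memLp_phase (hf : AEStronglyMeasurable f circleMeasure) :
    MemLp (phase f) ∞ circleMeasure := by
  classical
  have h1 : Measurable fun ζ : ℂ => if ζ = 0 then (1 : ℂ) else ζ / ‖ζ‖ :=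
    Measurable.ite (measurableSet_singleton 0) measurable_const (by fun_prop)
  have h2 : AEStronglyMeasurable (phase f) circleMeasure := by
    refine (h1.comp_aemeasurable hf.aemeasurable).aestronglyMeasurable.congr
      (Eventually.of_forall fun z => ?_)
    simp only [Function.comp, phase]
  exact memLp_top_of_bound h2 1 (Eventually.of_forall fun z => (norm_phase f z).le)

end Phase

/-! ### Irreducible subfactors generated by `U` and `vⁿ` -/

section Subfactor

open VonNeumannAlgebra

variable {H : Type w} [NormedAddCommGroup H] [InnerProductSpace ℂ H] [CompleteSpace H]
  {N R : VonNeumannAlgebra H} {u v U : unitary (H →L[ℂ] H)} {c : Circle} {f : Circle → ℂ}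

namespace IsLinftyCalc

variable {T : H →L[ℂ] H}

theorem commute (hac : ∀ ξ, spectralMeasure v ξ ≪ circleMeasure) (h : IsLinftyCalc v f T) :
    T * v = v * T := by
  have h1 := isLinftyCalc_circleCalc v (circleMonomial 1)
  rw [circleCalc_monomial, zpow_one] at h1
  refine (h.mul h1).unique hac ((h1.mul h).congr_ae (Eventually.of_forall fun z => mul_comm _ _))

/-- Unimodular functions of `v` are unitary. -/
theorem mem_unitary (hac : ∀ ξ, spectralMeasure v ξ ≪ circleMeasure) (h : IsLinftyCalc v f T)
    (hf : ∀ z, ‖f z‖ = 1) : T ∈ unitary (H →L[ℂ] H) := by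
  have h1 := isLinftyCalc_circleCalc v 1
  rw [map_one] at h1
  have hff : ∀ z, star (f z) * f z = 1 := fun z => by
    rw [Complex.star_def, ← Complex.normSq_eq_conj_mul_self, Complex.normSq_eq_norm_sq, hf]; simp
  rw [Unitary.mem_iff]
  constructor
  · exact (((h.adjoint hac).mul h).congr_ae (Eventually.of_forall hff)).unique hac h1
  · exact ((h.mul (h.adjoint hac)).congr_ae
      (Eventually.of_forall fun z => (mul_comm _ _).trans (hff z))).unique hac h1

end IsLinftyCalc

theorem isRotationPair_of_comm {θ : ℝ} (hirr : Irrational θ)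
    (hcomm : (v : H →L[ℂ] H) * (u : H →L[ℂ] H) =
      Complex.exp (2 * Real.pi * Complex.I * θ) • ((u : H →L[ℂ] H) * (v : H →L[ℂ] H))) :
    IsRotationPair u v (Circle.exp (2 * Real.pi * θ)) where
  comm := by
    refine Subtype.ext ?_
    rw [Submonoid.coe_mul, hcomm, Submonoid.coe_mul, coe_scalarUnitary, Submonoid.coe_mul,
      smul_mul_assoc, one_mul, Circle.coe_exp]
    congr 2
    push_cast
    ring
  irrational n hn h := by
    rw [← Circle.exp_intCast_mul, Circle.exp_eq_one] at h
    obtain ⟨m, hm⟩ := h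
    refine (hirr.intCast_mul hn).ne_int m ?_
    exact mul_right_cancel₀ Real.two_pi_pos.ne' (by linear_combination hm)

/-- Multiplying `u` by a unitary that commutes with `v` does not change the commutation relation. -/
theorem IsRotationPair.mul_right (hr : IsRotationPair u v c) {W : unitary (H →L[ℂ] H)}
    (hW : W * v = v * W) : IsRotationPair (u * W) v c where
  comm := by rw [← mul_assoc, hr.comm, mul_assoc, mul_assoc, mul_assoc, hW]
  irrational := hr.irrational

namespace VonNeumannAlgebra

/-- If `W` is a function of `v`, then `u W` and `v` generate the same algebra as `u` and `v`. The
hypothesis asks only that `W` belong to every algebra containing `v`. -/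
theorem generatedBy_mul_right {W : unitary (H →L[ℂ] H)}
    (hW : ∀ M : VonNeumannAlgebra H, (v : H →L[ℂ] H) ∈ M → (W : H →L[ℂ] H) ∈ M) :
    generatedBy {((u * W : unitary (H →L[ℂ] H)) : H →L[ℂ] H), (v : H →L[ℂ] H)} =
      generatedBy {(u : H →L[ℂ] H), (v : H →L[ℂ] H)} := by
  obtain ⟨hu, hv⟩ := mem_of_generatedBy_eq (U := u) (V := v) rfl
  obtain ⟨hu', hv'⟩ := mem_of_generatedBy_eq (U := u * W) (V := v) rfl
  refine le_antisymm (generatedBy_le ?_) (generatedBy_le ?_)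
  · rintro x (rfl | rfl)
    exacts [mul_mem hu (hW _ hv), hv]
  · rintro x (rfl | rfl)
    · have h1 := mul_mem hu' (star_mem (hW _ hv'))
      rwa [Submonoid.coe_mul, mul_assoc, Unitary.mul_star_self_of_mem W.2, mul_one] at h1
    · exact hv'

/-- The monomials in a rotation pair are linearly independent. -/
theorem not_finiteDimensional {V : unitary (H →L[ℂ] H)} (h : IsRotationPair U V c)
    {σ : N →ₚ[ℂ] ℂ} (hσ : IsTrace σ) (hU : (U : H →L[ℂ] H) ∈ N) (hV : (V : H →L[ℂ] H) ∈ N) :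
    ¬ FiniteDimensional ℂ N := by
  intro hfin
  have h1 : LinearIndependent ℂ (fun p => gnsHat σ (wordIn hU hV p)) :=
    (hσ.orthonormal_word h hU hV).linearIndependent
  have h2 : LinearIndependent ℂ (wordIn hU hV) := LinearIndependent.of_comp (gnsHat σ) h1
  have := h2.finite
  exact not_finite (ℤ × ℤ)

end VonNeumannAlgebra

/-- An algebra `N = {U, Vⁿ}''` is an irreducible subfactor of index `n` of `R = {U, V}''`. -/
theorem isII1Factor_irreducible_index {V : unitary (H →L[ℂ] H)} {τ : R →ₚ[ℂ] ℂ} (hτ : IsTrace τ)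
    (h : IsRotationPair U V c) {n : ℕ} (hn : n ≠ 0)
    (hR : generatedBy {(U : H →L[ℂ] H), (V : H →L[ℂ] H)} = R)
    (hN : generatedBy {(U : H →L[ℂ] H), ((V ^ n : unitary (H →L[ℂ] H)) : H →L[ℂ] H)} = N) :
    ∃ hNR : N ≤ R, N.IsII1Factor ∧ N.IsIrreducibleIn R ∧ jonesIndex τ N hNR = n := by
  obtain ⟨hU, hV⟩ := mem_of_generatedBy_eq hR
  obtain ⟨hUN, hVN⟩ := mem_of_generatedBy_eq hN
  have hNR : N ≤ R := by
    rw [← hN]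
    refine generatedBy_le ?_
    rintro x (rfl | rfl)
    · exact hU
    · simpa using pow_mem hV n
  have hirr : N.IsIrreducibleIn R := fun x hx hxN => by
    rw [VonNeumannAlgebra.mem_commutant_iff] at hxN
    exact hτ.eq_smul_one_of_commute h hR hn hx (hxN _ hUN) (hxN _ hVN)
  exact ⟨hNR, ⟨fun x hx => hirr x (hNR hx),
    not_finiteDimensional (h.pow hn) (hτ.restrict hNR) hUN hVN, _, hτ.restrict hNR⟩, hirr,
    jonesIndex_eq hτ h hn hR hN hNR⟩

end Subfactor

theorem mainTheorem5
    {H : Type w} [NormedAddCommGroup H] [InnerProductSpace ℂ H] [CompleteSpace H]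
    (R : VonNeumannAlgebra H) (hR : R.IsII1Factor) (hhyp : R.IsHyperfinite)
    (τ : R →ₚ[ℂ] ℂ) (hτ : VonNeumannAlgebra.IsTrace τ)
    (θ : ℝ) (hθ : θ ∈ Set.Ioo (0 : ℝ) 1) (hirr : Irrational θ)
    (u v : unitary (H →L[ℂ] H))
    (hgen : VonNeumannAlgebra.generatedBy {(u : H →L[ℂ] H), (v : H →L[ℂ] H)} = R)
    (hcomm : (v : H →L[ℂ] H) * (u : H →L[ℂ] H) =
      Complex.exp (2 * Real.pi * Complex.I * θ) • ((u : H →L[ℂ] H) * (v : H →L[ℂ] H)))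
    (f : Circle → ℂ) (hf : MeasureTheory.MemLp f ∞ circleMeasure)
    (hzero : circleMeasure {z | f z = 0} = 0)
    (hns : ∀ c : ℂ, functionalCalculus v (fun z => ((‖f z‖ : ℝ) : ℂ)) ≠ c • (1 : H →L[ℂ] H)) :
    ∃ hN : VonNeumannAlgebra.generatedBy {(u : H →L[ℂ] H) * functionalCalculus v f} ≤ R,
      (VonNeumannAlgebra.generatedBy {(u : H →L[ℂ] H) * functionalCalculus v f}).IsII1Factor ∧
      (VonNeumannAlgebra.generatedBy
        {(u : H →L[ℂ] H) * functionalCalculus v f}).IsIrreducibleIn R ∧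
      ∃ n : ℕ, 0 < n ∧
        VonNeumannAlgebra.jonesIndex τ
          (VonNeumannAlgebra.generatedBy {(u : H →L[ℂ] H) * functionalCalculus v f}) hN =
          (n : ℝ≥0∞) := by
  obtain ⟨hu, hv⟩ := VonNeumannAlgebra.mem_of_generatedBy_eq hgen
  have hr := isRotationPair_of_comm hirr hcomm
  have hac : ∀ ξ, spectralMeasure v ξ ≪ circleMeasure :=
    spectralMeasure_absolutelyContinuous hτ hv fun k x hk hx => by
      have h0 : x = VonNeumannAlgebra.wordIn hu hv (0, k) := Subtype.ext (by
        rw [hx]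
        change _ = ((rotationWord u v (0, k) : unitary (H →L[ℂ] H)) : H →L[ℂ] H)
        simp [rotationWord])
      rw [h0]
      exact hτ.wordIn_eq_zero hr hu hv fun h => hk (congrArg Prod.snd h)
  -- `f(v) = W |f|(v)`, where the unitary `W` commutes with `v`; put `U = u W` and `P = |f|(v)`
  have hfn : MemLp (fun z => ((‖f z‖ : ℝ) : ℂ)) ∞ circleMeasure := hf.norm.ofReal
  obtain ⟨P, hP⟩ := exists_isLinftyCalc hac hfn
  obtain ⟨W', hW'⟩ := exists_isLinftyCalc hac (memLp_phase hf.1)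
  obtain ⟨W, rfl⟩ : ∃ W : unitary (H →L[ℂ] H), (W : H →L[ℂ] H) = W' :=
    ⟨⟨W', hW'.mem_unitary hac (norm_phase f)⟩, rfl⟩
  have hWv : W * v = v * W := Subtype.ext (hW'.commute hac)
  have hf' : functionalCalculus v f = W * P :=
    ((hW'.mul hP).congr_ae (Eventually.of_forall (phase_mul_norm f))).functionalCalculus_eq hac
  have hns' : ∀ a : ℂ, P ≠ a • (1 : H →L[ℂ] H) := by rwa [hP.functionalCalculus_eq hac] at hns
  have hT : (u : H →L[ℂ] H) * functionalCalculus v f =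
      ((u * W : unitary (H →L[ℂ] H)) : H →L[ℂ] H) * P := by
    rw [hf', Submonoid.coe_mul, mul_assoc]
  rw [hT]
  have hmem := VonNeumannAlgebra.subset_generatedBy
    {((u * W : unitary (H →L[ℂ] H)) : H →L[ℂ] H) * P} rfl
  have hinj : ∀ ξ, P ξ = 0 → ξ = 0 := fun ξ =>
    hP.injective_of_ne_zero hac (by simpa using hzero)
  have hP0 := hP.nonneg hac
  obtain ⟨n, hn, hNn⟩ := hP.exists_generatedBy_eq hac (hr.mul_right hWv) hfn hns'
    (VonNeumannAlgebra.unitary_mem_of_mul_mem hP0 hinj hmem)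
    (VonNeumannAlgebra.mem_of_unitary_mul_mem hP0 hmem)
    (fun M hUM hPM => VonNeumannAlgebra.generatedBy_le (Set.singleton_subset_iff.2
      (mul_mem hUM hPM)))
  have hgen' := (VonNeumannAlgebra.generatedBy_mul_right (u := u) (v := v) (W := W)
    fun M hM => hW'.mem M hM).trans hgen
  obtain ⟨hNR, h1, h2, h3⟩ :=
    isII1Factor_irreducible_index hτ (hr.mul_right hWv) hn hgen' hNn
  exact ⟨hNR, h1, h2, n, Nat.pos_of_ne_zero hn, h3⟩
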